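/- Let $\mathcal H_A,\mathcal H_B$ be finite-dimensional Hilbert spaces, $\mathcal X$ a finite alphabet, $p_X$ a probability distribution on $\mathcal X$ and $\{\omega_{AB}^x\}_{x\in\mathcal X}$ density operators on $\mathcal H_A\otimes\mathcal H_B$. Put $\omega_{AB}=\sum_x p_X(x)\,\omega_{AB}^x$ and $\omega_{XAB}=\sum_x p_X(x)|x\rangle\langle x|\otimes\omega_{AB}^x$. A two-node coordination code of block length $n$ with message set $\{1,\dots,M\}$ consists of conditional distributions $p_{M|X^n}(\cdot|x^n)$ on the message set, states $\mathcal E(x)$ on $\mathcal H_A$ for $x\in\mathcal X$, and states $\rho_{B^n}^{(m)}$ on $\mathcal H_B^{\otimes n}$ for each message $m$. With $\rho_{A^n}^{(x^n)}=\bigotimes_{i=1}^n\mathcal E(x_i)$ and $p_X^n(x^n)=\prod_i p_X(x_i)$, the code induces the average state $$\overline\rho_{XAB}=\frac1n\sum_{i=1}^n\sum_{x^n\in\mathcal X^n}\sum_{m} p_X^n(x^n)\,p_{M|X^n}(m|x^n)\;|x_i\rangle\langle x_i|\otimes\rho_{A_i}^{(x^n)}\otimes\rho_{B_i}^{(m)}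 .$$ A rate $R\ge 0$ is achievable if for all $\varepsilon,\alpha>0$ and all sufficiently large $n$ there is a code of block length $n$ with $\lfloor 2^{n(R+\alpha)}\rfloor$ messages such that $\|\overline\rho_{XAB}-\omega_{XAB}\|_1\le\varepsilon$. The empirical coordination capacity $C_{\text{2-node}}(\omega)$ is the infimum of the achievable rates. Let $\mathscr S(\omega)$ be the set of all states $$\sigma_{XYAB}=\sum_{x\in\mathcal X,\,y\in\mathcal Y}p_{XY}(x,y)\,|x\rangle\langle x|\otimes|y\rangle\langle y|\otimes\sigma_A^x\otimes\sigma_B^y ,$$ with $\mathcal Y$ an arbitrary finite alphabet, $p_{XY}$ a probability distribution on $\mathcal X\times\mathcal Y$ and $\sigma_A^x,\sigma_B^y$ density operators, such that $\sigma_{XAB}=\omega_{XAB}$. Let $I(X;Y)_\sigma=H(X)_\sigma+H(Y)_\sigma-H(XY)_\sigma$, with von Neumann entropies in bits. Theorem. 1. If $\mathscr S(\omega)\neq\emptyset$, then some rate is achievable and $$C_{\text{2-node}}(\omega)=\inf_{\sigma\in\mathscr S(\omega)}I(X;Y)_\sigma .$$ 2. If $\mathscr S(\omega)=\emptyset$,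 then coordination is impossible: no rate $R\ge0$ is achievable. 3. If $\omega_{AB}$ is entangled (not separable), then $\mathscr S(\omega)=\emptyset$, so that the case of item 2 applies. -/

import Mathlib

open scoped Kronecker ComplexOrder

noncomputable section

namespace EmpiricalCoordination

/-- Density operators on the finite-dimensional Hilbert space with orthonormal basis `d`:
positive semidefinite operators of trace one. -/
def IsDensity {d : Type*} [Fintype d] (ρ : Matrix d d ℂ) : Prop :=
  ρ.PosSemidef ∧ ρ.trace = 1

/-- The trace norm `Tr |M| = Tr √(M† M)`, i.e. the sum of the singular values of `M`. -/
def traceNorm {d : Type*} [Fintype d] [DecidableEq d] (M : Matrix d d ℂ) : ℝ :=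
  ∑ i, √((Matrix.isHermitian_conjTranspose_mul_self M).eigenvalues i)

open Classical in
/-- The von Neumann entropy `-Tr (ρ log₂ ρ)` of a Hermitian operator, computed from its
eigenvalues (with `0 log 0 = 0`). The value for non-Hermitian matrices is immaterial. -/
def vonNeumannEntropy {d : Type*} [Fintype d] [DecidableEq d] (ρ : Matrix d d ℂ) : ℝ :=
  if h : ρ.IsHermitian then -∑ i, h.eigenvalues i * Real.logb 2 (h.eigenvalues i) else 0

/-- Partial trace over the second tensor factor. -/
def traceRight {d e : Type*} [Fintype e] (ρ : Matrix (d × e) (d × e) ℂ) : Matrix d d ℂ :=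
  Matrix.of fun s t => ∑ u, ρ (s, u) (t, u)

/-- Partial trace over the first tensor factor. -/
def traceLeft {d e : Type*} [Fintype d] (ρ : Matrix (d × e) (d × e) ℂ) : Matrix e e ℂ :=
  Matrix.of fun s t => ∑ u, ρ (u, s) (u, t)

/-- The quantum mutual information (in bits) `H(D)_ρ + H(E)_ρ - H(DE)_ρ` of a bipartite state. -/
def mutualInfo {d e : Type*} [Fintype d] [DecidableEq d] [Fintype e] [DecidableEq e]
    (ρ : Matrix (d × e) (d × e) ℂ) : ℝ :=
  vonNeumannEntropy (traceRight ρ) + vonNeumannEntropy (traceLeft ρ) - vonNeumannEntropy ρ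

/-- The rank-one projector `|x⟩⟨x|` on a basis vector. -/
def basisProj {d : Type*} [DecidableEq d] (x : d) : Matrix d d ℂ :=
  Matrix.single x x 1

/-- The tensor product `⨂ i, ρ i` of `n` operators, on the `n`-fold tensor power. -/
def tensorPi {d : Type*} {n : ℕ} (ρ : Fin n → Matrix d d ℂ) :
    Matrix (Fin n → d) (Fin n → d) ℂ :=
  Matrix.of fun u v => ∏ i, ρ i (u i) (v i)

/-- The reduced operator of the `i`-th subsystem of an operator on an `n`-fold tensor power
(partial trace over all the other subsystems). -/
def marginal {d : Type*} [Fintype d] [DecidableEq d] {n : ℕ} (i : Fin n)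
    (ρ : Matrix (Fin n → d) (Fin n → d) ℂ) : Matrix d d ℂ :=
  Matrix.of fun s t => ∑ u : Fin n → d, if u i = s then ρ u (Function.update u i t) else 0

/-- Separability of a bipartite state: a finite convex combination of product states. -/
def IsSeparable {a b : Type*} [Fintype a] [Fintype b]
    (ρ : Matrix (a × b) (a × b) ℂ) : Prop :=
  ∃ (k : ℕ) (q : Fin k → ℝ) (ρA : Fin k → Matrix a a ℂ) (ρB : Fin k → Matrix b b ℂ),
    q ∈ stdSimplex ℝ (Fin k) ∧ (∀ j, IsDensity (ρA j)) ∧ (∀ j, IsDensity (ρB j)) ∧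
    ρ = ∑ j, (q j : ℂ) • (ρA j ⊗ₖ ρB j)

section Network

variable {X a b : Type*} [Fintype X] [DecidableEq X] [Fintype a] [DecidableEq a]
  [Fintype b] [DecidableEq b]

/-- The average state `ω_AB = ∑ₓ p(x) ω_AB^x` of an ensemble. -/
def averageAB (p : X → ℝ) (ω : X → Matrix (a × b) (a × b) ℂ) : Matrix (a × b) (a × b) ℂ :=
  ∑ x, (p x : ℂ) • ω x

/-- The c-q state `ω_XAB = ∑ₓ p(x) |x⟩⟨x| ⊗ ω_AB^x` of an ensemble. -/
def cqState (p : X → ℝ) (ω : X → Matrix (a × b) (a × b) ℂ) :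
    Matrix (X × (a × b)) (X × (a × b)) ℂ :=
  ∑ x, (p x : ℂ) • (basisProj x ⊗ₖ ω x)

/-- The reduced operator on `XAB` of an operator on `XYAB`. -/
def reduceXAB {Y : Type*} [Fintype Y]
    (σ : Matrix (X × (Y × (a × b))) (X × (Y × (a × b))) ℂ) :
    Matrix (X × (a × b)) (X × (a × b)) ℂ :=
  Matrix.of fun s t => ∑ y, σ (s.1, (y, s.2)) (t.1, (y, t.2))

/-- The reduced operator on `XY` of an operator on `XYAB`. -/
def reduceXY {Y : Type*} (σ : Matrix (X × (Y × (a × b))) (X × (Y × (a × b))) ℂ) :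
    Matrix (X × Y) (X × Y) ℂ :=
  Matrix.of fun s t => ∑ v : a × b, σ (s.1, (s.2, v)) (t.1, (t.2, v))

/-- `σ_XYAB = ∑ p(x,y) |x⟩⟨x| ⊗ |y⟩⟨y| ⊗ σ_A^x ⊗ σ_B^y` for some joint distribution of
`(X, Y)` and some states `σ_A^x`, `σ_B^y`, and `σ_XAB = ω_XAB`. -/
def IsExtension {Y : Type*} [Fintype Y] [DecidableEq Y] (p : X → ℝ)
    (ω : X → Matrix (a × b) (a × b) ℂ)
    (σ : Matrix (X × (Y × (a × b))) (X × (Y × (a × b))) ℂ) : Prop :=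
  (∃ (q : X × Y → ℝ) (σA : X → Matrix a a ℂ) (σB : Y → Matrix b b ℂ),
    q ∈ stdSimplex ℝ (X × Y) ∧ (∀ x, IsDensity (σA x)) ∧ (∀ y, IsDensity (σB y)) ∧
    σ = ∑ x, ∑ y, (q (x, y) : ℂ) • (basisProj x ⊗ₖ (basisProj y ⊗ₖ (σA x ⊗ₖ σB y)))) ∧
  reduceXAB σ = cqState p ω

/-- The set of all separable c-q extensions of `ω_XAB`. The alphabet of `Y` is an arbitrary
finite set, taken to be `Fin k` with `k` ranging over all natural numbers. -/
def extensions (p : X → ℝ) (ω : X → Matrix (a × b) (a × b) ℂ) :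
    Set (Σ k : ℕ, Matrix (X × (Fin k × (a × b))) (X × (Fin k × (a × b))) ℂ) :=
  {σ | IsExtension p ω σ.2}

variable (X a b) in
/-- A coordination code of block length `n` with `M` messages for the two-node network. -/
structure Code (n M : ℕ) where
  /-- Alice's random message selection: `enc xⁿ m` is the probability of `m` given `xⁿ`. -/
  enc : (Fin n → X) → Fin M → ℝ
  enc_mem : ∀ x, enc x ∈ stdSimplex ℝ (Fin M)
  /-- Alice's c-q encoding channel, applied to each letter. -/
  alice : X → Matrix a a ℂ
  alice_density : ∀ x, IsDensity (alice x)
  /-- Bob's c-q decoding channel. -/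
  bob : Fin M → Matrix (Fin n → b) (Fin n → b) ℂ
  bob_density : ∀ m, IsDensity (bob m)

/-- Alice's state `ρ_{Aⁿ}` given the source sequence `xⁿ`. -/
def Code.aliceState {n M : ℕ} (c : Code X a b n M) (x : Fin n → X) :
    Matrix (Fin n → a) (Fin n → a) ℂ :=
  tensorPi fun i => c.alice (x i)

/-- The average state over the block, jointly with the source letter:
`(1/n) ∑ᵢ ∑_{xⁿ} ∑ₘ p(x₁)⋯p(xₙ) p(m|xⁿ) |xᵢ⟩⟨xᵢ| ⊗ ρ_{Aᵢ} ⊗ ρ_{Bᵢ}`. -/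
def Code.averageState {n M : ℕ} (p : X → ℝ) (c : Code X a b n M) :
    Matrix (X × (a × b)) (X × (a × b)) ℂ :=
  (1 / (n : ℂ)) • ∑ i : Fin n, ∑ x : Fin n → X, ∑ m : Fin M,
    (((∏ j, p (x j)) * c.enc x m : ℝ) : ℂ) •
      (basisProj (x i) ⊗ₖ (marginal i (c.aliceState x) ⊗ₖ marginal i (c.bob m)))

/-- The rate `R ≥ 0` is achievable: for all `ε, α > 0` and all sufficiently large `n` there is a
`(2^{n(R+α)}, n)` code whose average state is `ε`-close to `ω_XAB` in trace norm. -/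
def Achievable (p : X → ℝ) (ω : X → Matrix (a × b) (a × b) ℂ) (R : ℝ) : Prop :=
  0 ≤ R ∧ ∀ ε > 0, ∀ α > 0, ∃ N : ℕ, ∀ n ≥ N,
    ∃ c : Code X a b n ⌊(2 : ℝ) ^ ((n : ℝ) * (R + α))⌋₊,
      traceNorm (c.averageState p - cqState p ω) ≤ ε

/-- The empirical coordination capacity: the infimum of the achievable rates. (A real infimum:
it is meaningful only when some rate is achievable.) -/
def capacity (p : X → ℝ) (ω : X → Matrix (a × b) (a × b) ℂ) : ℝ :=
  sInf {R | Achievable p ω R}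

end Network

end EmpiricalCoordination

end

/-!
The capacity formula rests on two facts about the ensembles `q(x,y) σ_A^x ⊗ σ_B^y` that realize the
target state exactly: their classical mutual information is an achievable rate, and conversely every
achievable rate is at least the mutual information of one of them.

*Direct part* (`achievable_shannonMutualInfo`). Alice looks for a codeword `yⁿ(m)` that is jointly
typical with the source sequence, and Bob prepares `⨂ᵢ σ_B^{yᵢ(m)}`. The average state then depends
only on the expected joint type of `(xⁿ, yⁿ(m))`, so it is close to the target as soon as this type
is close to `q`. That a codebook of `2^{n(I(X;Y)+α)}` sequences suffices is the covering lemma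
`exists_codebook`, applied with the bound `prod_le_of_isTypical` on typical pairs; atypical pairs
are rare by Chebyshev's inequality (`sum_not_isTypical_le`).

*Converse part* (`Achievable.exists_mutualInfo_le`). Since Alice's states are products, the average
state of a code is itself the state of an ensemble, whose label `y = (i, m)` is a uniform position
together with the message. As the source is i.i.d., Jensen's inequality bounds the mutual
information of this ensemble by `log M / n` (`Code.exists_conditional`). The size of the label
alphabet grows with `n`, but both the state and `H(X|Y)` depend only on Alice's states and on a
point of the convex hull of the compact set `labelPoints`. In finite dimension this hull is compact
(`isCompact_convexHull`, from Carathéodory's theorem), so codes of vanishing error have a limit,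
which is an exact ensemble on a finite alphabet with `H(X|Y) ≥ H(X) - R`. In particular, no rate
is achievable when there is no extension.

The trace norm enters only through its equivalence with the matrix entries, and the von Neumann
entropies only for diagonal matrices, where they are Shannon entropies. Finally, tracing `XY` out of
an extension displays `ω_AB` as a convex combination of product states, so an entangled
`ω_AB` has no extension.
-/

noncomputable section

namespace EmpiricalCoordination

/-! ### Trace norm and entropy in terms of matrix entries -/

/-- The Shannon entropy, in bits, of a weight function on a finite alphabet. -/
def shannonEntropy {ι : Type*} [Fintype ι] (r : ι → ℝ) : ℝ :=
  -∑ i, r i * Real.logb 2 (r i)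

lemma vonNeumannEntropy_diagonal {ι : Type*} [Fintype ι] [DecidableEq ι] (r : ι → ℝ) :
    vonNeumannEntropy (Matrix.diagonal fun i => (r i : ℂ)) = shannonEntropy r := by
  have h : (Matrix.diagonal fun i => (r i : ℂ)).IsHermitian := by
    rw [Matrix.isHermitian_diagonal_iff]
    intro i
    simp [isSelfAdjoint_iff]
  have hroots := h.roots_charpoly_eq_eigenvalues
  rw [Matrix.charpoly_diagonal, Polynomial.roots_prod _ _
    (Finset.prod_ne_zero_iff.2 fun i _ => Polynomial.X_sub_C_ne_zero _)] at hroots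
  simp only [Polynomial.roots_X_sub_C, Multiset.bind_singleton] at hroots
  have hre := congrArg (fun s : Multiset ℂ =>
    (s.map fun z : ℂ => z.re * Real.logb 2 z.re).sum) hroots
  simp only [Multiset.map_map, Function.comp_apply, Complex.ofReal_re, Complex.coe_algebraMap]
    at hre
  rw [vonNeumannEntropy, dif_pos h, shannonEntropy]
  exact congrArg Neg.neg hre.symm

lemma sum_eigenvalues_conjTranspose_mul_self {d : Type*} [Fintype d] [DecidableEq d]
    (M : Matrix d d ℂ) :
    ∑ i, (Matrix.isHermitian_conjTranspose_mul_self M).eigenvalues i =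
      ∑ j, ∑ i, ‖M i j‖ ^ 2 := by
  have h := (Matrix.isHermitian_conjTranspose_mul_self M).trace_eq_sum_eigenvalues
  have h2 : (M.conjTranspose * M).trace = ((∑ j, ∑ i, ‖M i j‖ ^ 2 : ℝ) : ℂ) := by
    simp only [Matrix.trace, Matrix.diag, Matrix.mul_apply, Matrix.conjTranspose_apply]
    push_cast
    refine Finset.sum_congr rfl fun j _ => Finset.sum_congr rfl fun i _ => ?_
    simpa using Complex.conj_mul' (M i j)
  rw [h2] at h
  exact Complex.ofReal_injective ((Complex.ofReal_sum _ _).trans h.symm)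

lemma norm_apply_le_traceNorm {d : Type*} [Fintype d] [DecidableEq d] (M : Matrix d d ℂ)
    (i j : d) : ‖M i j‖ ≤ traceNorm M := by
  have hM := Matrix.posSemidef_conjTranspose_mul_self M
  have h0 : 0 ≤ traceNorm M := Finset.sum_nonneg fun i _ => Real.sqrt_nonneg _
  have hsq : ‖M i j‖ ^ 2 ≤ traceNorm M ^ 2 := calc
    ‖M i j‖ ^ 2 ≤ ∑ i, ‖M i j‖ ^ 2 :=
      Finset.single_le_sum (f := fun i => ‖M i j‖ ^ 2) (fun _ _ => by positivity)
        (Finset.mem_univ i)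
    _ ≤ ∑ j, ∑ i, ‖M i j‖ ^ 2 :=
      Finset.single_le_sum (f := fun j => ∑ i, ‖M i j‖ ^ 2) (fun _ _ => by positivity)
        (Finset.mem_univ j)
    _ = ∑ i, √((Matrix.isHermitian_conjTranspose_mul_self M).eigenvalues i) ^ 2 := by
      rw [← sum_eigenvalues_conjTranspose_mul_self]
      exact Finset.sum_congr rfl fun i _ => (Real.sq_sqrt (hM.eigenvalues_nonneg i)).symm
    _ ≤ traceNorm M ^ 2 := Finset.sum_sq_le_sq_sum_of_nonneg fun i _ => Real.sqrt_nonneg _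
  exact abs_le_of_sq_le_sq' hsq h0 |>.2

lemma traceNorm_le {d : Type*} [Fintype d] [DecidableEq d] (M : Matrix d d ℂ) :
    traceNorm M ≤ Fintype.card d * ∑ j, ∑ i, ‖M i j‖ := by
  have hM := Matrix.posSemidef_conjTranspose_mul_self M
  have key : ∀ i, √((Matrix.isHermitian_conjTranspose_mul_self M).eigenvalues i) ≤
      ∑ j, ∑ i, ‖M i j‖ := by
    intro i
    refine Real.sqrt_le_iff.2 ⟨by positivity, ?_⟩
    calc (Matrix.isHermitian_conjTranspose_mul_self M).eigenvalues i
        ≤ ∑ i, (Matrix.isHermitian_conjTranspose_mul_self M).eigenvalues i :=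
          Finset.single_le_sum (fun i _ => hM.eigenvalues_nonneg i) (Finset.mem_univ i)
      _ = ∑ j, ∑ i, ‖M i j‖ ^ 2 := sum_eigenvalues_conjTranspose_mul_self M
      _ ≤ ∑ j, (∑ i, ‖M i j‖) ^ 2 := Finset.sum_le_sum fun j _ =>
          Finset.sum_sq_le_sq_sum_of_nonneg fun _ _ => norm_nonneg _
      _ ≤ (∑ j, ∑ i, ‖M i j‖) ^ 2 :=
          Finset.sum_sq_le_sq_sum_of_nonneg fun _ _ => by positivity
  calc traceNorm M ≤ ∑ _i : d, ∑ j, ∑ i, ‖M i j‖ := Finset.sum_le_sum fun i _ => key i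
    _ = _ := by simp

/-! ### Tensor powers and their marginals -/

lemma trace_tensorPi {d : Type*} [Fintype d] [DecidableEq d] {n : ℕ}
    (ρ : Fin n → Matrix d d ℂ) : (tensorPi ρ).trace = ∏ i, (ρ i).trace := by
  simp only [Matrix.trace, Matrix.diag, tensorPi, Matrix.of_apply]
  exact (Fintype.prod_sum fun i s => ρ i s s).symm

open scoped MatrixOrder in
lemma posSemidef_tensorPi {d : Type*} [Fintype d] [DecidableEq d] {n : ℕ}
    {ρ : Fin n → Matrix d d ℂ} (h : ∀ i, (ρ i).PosSemidef) : (tensorPi ρ).PosSemidef := by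
  have hB : ∀ i, ∃ B : Matrix d d ℂ, ρ i = B.conjTranspose * B := fun i =>
    CStarAlgebra.nonneg_iff_eq_star_mul_self.mp (h i).nonneg
  choose B hB using hB
  -- square roots of the factors tensor to a square root of the product
  have hprod : tensorPi ρ = (tensorPi B).conjTranspose * tensorPi B := by
    ext u v
    simp only [tensorPi, Matrix.of_apply, Matrix.mul_apply, Matrix.conjTranspose_apply, hB,
      star_prod, ← Finset.prod_mul_distrib]
    exact Fintype.prod_sum fun i s => star (B i s (u i)) * B i s (v i)
  rw [hprod]
  exact Matrix.posSemidef_conjTranspose_mul_self _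

lemma isDensity_tensorPi {d : Type*} [Fintype d] [DecidableEq d] {n : ℕ}
    {ρ : Fin n → Matrix d d ℂ} (h : ∀ i, IsDensity (ρ i)) : IsDensity (tensorPi ρ) :=
  ⟨posSemidef_tensorPi fun i => (h i).1, by
    rw [trace_tensorPi]
    exact Finset.prod_eq_one fun i _ => (h i).2⟩

lemma marginal_tensorPi {d : Type*} [Fintype d] [DecidableEq d] {n : ℕ}
    {ρ : Fin n → Matrix d d ℂ} (h : ∀ i, (ρ i).trace = 1) (i : Fin n) :
    marginal i (tensorPi ρ) = ρ i := by
  ext s t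
  let F : Fin n → d → ℂ := fun j v =>
    if j = i then (if v = s then ρ i v t else 0) else ρ j v v
  have hF : ∀ u : Fin n → d,
      (if u i = s then tensorPi ρ u (Function.update u i t) else 0) = ∏ j, F j (u j) := by
    intro u
    rw [← Finset.mul_prod_erase _ _ (Finset.mem_univ i)]
    by_cases hu : u i = s
    · simp only [hu, if_true, tensorPi, Matrix.of_apply, F]
      rw [← Finset.mul_prod_erase _ _ (Finset.mem_univ i)]
      simp only [Function.update_self, hu]
      congr 1
      refine Finset.prod_congr rfl fun j hj => ?_
      have hj' : j ≠ i := (Finset.mem_erase.1 hj).1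
      simp [hj']
    · simp [F, hu]
  simp only [marginal, Matrix.of_apply]
  rw [Finset.sum_congr rfl fun u _ => hF u, ← Fintype.prod_sum F,
    ← Finset.mul_prod_erase _ _ (Finset.mem_univ i), Finset.prod_eq_one, mul_one]
  · simp [F]
  · intro j hj
    have hj' : j ≠ i := (Finset.mem_erase.1 hj).1
    simpa [F, hj', Matrix.trace] using h j

lemma isDensity_marginal {d : Type*} [Fintype d] [DecidableEq d] {n : ℕ} (i : Fin n)
    {ρ : Matrix (Fin n → d) (Fin n → d) ℂ} (h : IsDensity ρ) : IsDensity (marginal i ρ) := by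
  constructor
  · -- the marginal is a sum of principal submatrices, one for each value of the other letters
    have hsum : marginal i ρ = ∑ v : {j // j ≠ i} → d,
        ρ.submatrix (fun s => (Equiv.funSplitAt i d).symm (s, v))
          (fun s => (Equiv.funSplitAt i d).symm (s, v)) := by
      ext s t
      simp only [marginal, Matrix.of_apply, Matrix.sum_apply, Matrix.submatrix_apply]
      rw [← (Equiv.funSplitAt i d).symm.sum_comp, Fintype.sum_prod_type, Finset.sum_comm]
      refine Finset.sum_congr rfl fun v _ => ?_
      rw [Finset.sum_eq_single s]
      · have hu : Function.update ((Equiv.funSplitAt i d).symm (s, v)) i t =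
            (Equiv.funSplitAt i d).symm (t, v) := by
          ext j
          by_cases hj : j = i
          · subst hj; simp
          · simp [hj]
        simp [hu]
      · intro s' _ hs'
        simp [hs']
      · simp
    rw [hsum]
    exact Matrix.posSemidef_sum _ fun v _ => h.1.submatrix _
  · rw [← h.2]
    simp only [Matrix.trace, Matrix.diag, marginal, Matrix.of_apply]
    rw [Finset.sum_comm]
    refine Finset.sum_congr rfl fun u _ => ?_
    simp

/-! ### Compactness of convex hulls in finite dimension -/

/-- By Carathéodory's theorem the convex hull is the continuous image of the compact set of
weighted families of `dim V + 1` points. -/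
lemma isCompact_convexHull {V : Type*} [AddCommGroup V] [Module ℝ V] [TopologicalSpace V]
    [IsTopologicalAddGroup V] [ContinuousSMul ℝ V] [FiniteDimensional ℝ V] {K : Set V}
    (hK : IsCompact K) : IsCompact (convexHull ℝ K) := by
  classical
  let D := Module.finrank ℝ V + 1
  have himg : convexHull ℝ K = (fun z : (Fin D → ℝ) × (Fin D → V) => ∑ i, z.1 i • z.2 i) ''
      (stdSimplex ℝ (Fin D) ×ˢ Set.univ.pi fun _ => K) := by
    ext v
    constructor
    · intro hv
      obtain ⟨ι, _, z, w, hz, hind, hw, hw1, rfl⟩ := eq_pos_convex_span_of_mem_convexHull hv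
      have hcard : Fintype.card ι ≤ Fintype.card (Fin D) := by
        rw [Fintype.card_fin]
        exact hind.card_le_finrank_succ.trans
          (Nat.succ_le_succ (Submodule.finrank_le _))
      obtain ⟨e⟩ := Function.Embedding.nonempty_of_card_le hcard
      have hι : Nonempty ι := by
        by_contra hne
        rw [not_nonempty_iff] at hne
        simp at hw1
      obtain ⟨i₀⟩ := hι
      refine ⟨(Function.extend e w 0, Function.extend e z fun _ => z i₀), ⟨⟨?_, ?_⟩, ?_⟩, ?_⟩
      · intro j
        by_cases hj : ∃ i, e i = j
        · obtain ⟨i, rfl⟩ := hj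
          simpa [e.injective.extend_apply] using (hw i).le
        · simp [Function.extend_apply' _ _ _ hj]
      · rw [← hw1]
        refine (Fintype.sum_of_injective e e.injective _ _ ?_ ?_).symm
        · intro j hj
          exact Function.extend_apply' _ _ _ hj
        · intro i
          exact (e.injective.extend_apply _ _ i).symm
      · intro j _
        by_cases hj : ∃ i, e i = j
        · obtain ⟨i, rfl⟩ := hj
          simpa [e.injective.extend_apply] using hz ⟨i, rfl⟩
        · simpa [Function.extend_apply' _ _ _ hj] using hz ⟨i₀, rfl⟩
      · refine (Fintype.sum_of_injective e e.injective _ _ ?_ ?_).symm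
        · intro j hj
          have := Function.extend_apply' (f := e) w 0 j hj
          simp [this]
        · intro i
          simp [e.injective.extend_apply]
    · rintro ⟨⟨w, z⟩, ⟨hw, hz⟩, rfl⟩
      exact mem_convexHull_of_exists_fintype w z hw.1 hw.2 (fun i => hz i trivial) rfl
  rw [himg]
  exact ((isCompact_stdSimplex ℝ (Fin D)).prod (isCompact_univ_pi fun _ => hK)).image
    (by fun_prop)

/-! ### Classical mutual information -/

/-- The mutual information `H(X) + H(Y) - H(XY)`, in bits, of a joint distribution. -/
def shannonMutualInfo {X Y : Type*} [Fintype X] [Fintype Y] (q : X × Y → ℝ) : ℝ :=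
  shannonEntropy (fun x => ∑ y, q (x, y)) + shannonEntropy (fun y => ∑ x, q (x, y)) -
    shannonEntropy q

/-- Jensen's inequality for the logarithm, with possibly vanishing weights. -/
lemma sum_mul_logb_le {ι : Type*} [Fintype ι] {w a : ι → ℝ} {c : ℝ} (hw : w ∈ stdSimplex ℝ ι)
    (ha : ∀ i, 0 < w i → 0 < a i) (hc : 0 < c) (hsum : ∑ i, w i * a i ≤ c) :
    ∑ i, w i * Real.logb 2 (a i) ≤ Real.logb 2 c := by
  have hlog2 : 0 < Real.log 2 := Real.log_pos one_lt_two
  have hterm : ∀ i, w i * Real.log (a i) ≤ w i * a i / c - w i + w i * Real.log c := by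
    intro i
    rcases (hw.1 i).eq_or_lt with h0 | h0
    · simp [← h0]
    · have h := Real.log_le_sub_one_of_pos (div_pos (ha i h0) hc)
      rw [Real.log_div (ha i h0).ne' hc.ne'] at h
      have := mul_le_mul_of_nonneg_left h h0.le
      calc w i * Real.log (a i) = w i * (Real.log (a i) - Real.log c) + w i * Real.log c := by ring
        _ ≤ w i * (a i / c - 1) + w i * Real.log c := by gcongr
        _ = _ := by ring
  have h := Finset.sum_le_sum fun i (_ : i ∈ Finset.univ) => hterm i
  rw [Finset.sum_add_distrib, Finset.sum_sub_distrib, ← Finset.sum_div, ← Finset.sum_mul, hw.2,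
    one_mul] at h
  have h1 : (∑ i, w i * a i) / c ≤ 1 := (div_le_one hc).2 hsum
  simp only [Real.logb, mul_div_assoc', ← Finset.sum_div]
  gcongr
  linarith

lemma shannonMutualInfo_eq_sum {X Y : Type*} [Fintype X] [Fintype Y] {q : X × Y → ℝ}
    (hq : ∀ z, 0 ≤ q z) :
    shannonMutualInfo q = ∑ z : X × Y, q z *
      Real.logb 2 (q z / ((∑ y, q (z.1, y)) * ∑ x, q (x, z.2))) := by
  have hterm : ∀ z : X × Y, q z * Real.logb 2 (q z / ((∑ y, q (z.1, y)) * ∑ x, q (x, z.2))) =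
      q z * Real.logb 2 (q z) - q z * Real.logb 2 (∑ y, q (z.1, y)) -
        q z * Real.logb 2 (∑ x, q (x, z.2)) := by
    rintro ⟨x, y⟩
    rcases (hq (x, y)).eq_or_lt with h0 | h0
    · simp [← h0]
    · have hx : 0 < ∑ y, q (x, y) := h0.trans_le
        (Finset.single_le_sum (f := fun y => q (x, y)) (fun _ _ => hq _) (Finset.mem_univ y))
      have hy : 0 < ∑ x, q (x, y) := h0.trans_le
        (Finset.single_le_sum (f := fun x => q (x, y)) (fun _ _ => hq _) (Finset.mem_univ x))
      rw [Real.logb_div h0.ne' (mul_pos hx hy).ne', Real.logb_mul hx.ne' hy.ne']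
      ring
  rw [Finset.sum_congr rfl fun z _ => hterm z, Finset.sum_sub_distrib, Finset.sum_sub_distrib]
  have hX : ∑ z : X × Y, q z * Real.logb 2 (∑ y, q (z.1, y)) =
      ∑ x, (∑ y, q (x, y)) * Real.logb 2 (∑ y, q (x, y)) := by
    simp only [Fintype.sum_prod_type, Finset.sum_mul]
  have hY : ∑ z : X × Y, q z * Real.logb 2 (∑ x, q (x, z.2)) =
      ∑ y, (∑ x, q (x, y)) * Real.logb 2 (∑ x, q (x, y)) := by
    simp only [Fintype.sum_prod_type_right, Finset.sum_mul]
  rw [hX, hY]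
  simp only [shannonMutualInfo, shannonEntropy]
  ring

lemma shannonMutualInfo_nonneg {X Y : Type*} [Fintype X] [Fintype Y] {q : X × Y → ℝ}
    (hq : q ∈ stdSimplex ℝ (X × Y)) : 0 ≤ shannonMutualInfo q := by
  rw [shannonMutualInfo_eq_sum hq.1]
  have hx0 : ∀ x, 0 ≤ ∑ y, q (x, y) := fun x => Finset.sum_nonneg fun _ _ => hq.1 _
  have hy0 : ∀ y, 0 ≤ ∑ x, q (x, y) := fun x => Finset.sum_nonneg fun _ _ => hq.1 _
  have h := sum_mul_logb_le (c := 1) hq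
    (a := fun z => (q z / ((∑ y, q (z.1, y)) * ∑ x, q (x, z.2)))⁻¹) ?_ one_pos ?_
  · simp only [Real.logb_inv, mul_neg, Finset.sum_neg_distrib, Real.logb_one] at h
    linarith
  · rintro ⟨x, y⟩ h0
    have hx : 0 < ∑ y, q (x, y) := h0.trans_le
      (Finset.single_le_sum (f := fun y => q (x, y)) (fun _ _ => hq.1 _) (Finset.mem_univ y))
    have hy : 0 < ∑ x, q (x, y) := h0.trans_le
      (Finset.single_le_sum (f := fun x => q (x, y)) (fun _ _ => hq.1 _) (Finset.mem_univ x))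
    dsimp only
    positivity
  · calc _ ≤ ∑ z : X × Y, (∑ y, q (z.1, y)) * ∑ x, q (x, z.2) := by
          refine Finset.sum_le_sum fun z _ => ?_
          rcases (hq.1 z).eq_or_lt with h0 | h0
          · rw [← h0, zero_mul]
            exact mul_nonneg (hx0 _) (hy0 _)
          · rw [inv_div, mul_div_cancel₀ _ h0.ne']
      _ = (∑ x, ∑ y, q (x, y)) * ∑ y, ∑ x, q (x, y) := by
          rw [Fintype.sum_prod_type, Finset.sum_mul_sum]
      _ = 1 := by
          rw [← Fintype.sum_prod_type, ← Fintype.sum_prod_type_right, hq.2, one_mul]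

/-- `I(X;Y) = H(X) - H(X|Y)`, for a joint distribution given by the distribution `w` of `Y` and the
conditional distributions `r y` of `X`. -/
lemma shannonMutualInfo_mul {X Y : Type*} [Fintype X] [Fintype Y] (w : Y → ℝ) (r : Y → X → ℝ)
    (hr : ∀ y, r y ∈ stdSimplex ℝ X) :
    shannonMutualInfo (fun z : X × Y => w z.2 * r z.2 z.1) =
      shannonEntropy (fun x => ∑ y, w y * r y x) - ∑ y, w y * shannonEntropy (r y) := by
  have hY : ∀ y, ∑ x, w y * r y x = w y := fun y => by rw [← Finset.mul_sum, (hr y).2, mul_one]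
  have hXY : ∑ z : X × Y, w z.2 * r z.2 z.1 * Real.logb 2 (w z.2 * r z.2 z.1) =
      ∑ y, w y * Real.logb 2 (w y) + ∑ y, w y * ∑ x, r y x * Real.logb 2 (r y x) := by
    rw [Fintype.sum_prod_type_right, ← Finset.sum_add_distrib]
    refine Finset.sum_congr rfl fun y _ => ?_
    have hterm : ∀ x, w y * r y x * Real.logb 2 (w y * r y x) =
        r y x * (w y * Real.logb 2 (w y)) + w y * (r y x * Real.logb 2 (r y x)) := by
      intro x
      by_cases hw : w y = 0
      · simp [hw]
      by_cases hx : r y x = 0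
      · simp [hx]
      rw [Real.logb_mul hw hx]
      ring
    simp only [hterm]
    rw [Finset.sum_add_distrib, ← Finset.sum_mul, (hr y).2, one_mul, ← Finset.mul_sum]
  simp only [shannonMutualInfo, shannonEntropy, hY, hXY, mul_neg, Finset.sum_neg_distrib]
  ring

lemma continuous_shannonEntropy {X : Type*} [Fintype X] :
    Continuous (shannonEntropy : (X → ℝ) → ℝ) := by
  have h : (shannonEntropy : (X → ℝ) → ℝ) =
      fun r => (∑ x, Real.negMulLog (r x)) / Real.log 2 := by
    funext r
    simp only [shannonEntropy, Real.negMulLog, Real.logb, mul_div_assoc', neg_mul,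
      Finset.sum_neg_distrib, ← Finset.sum_div, neg_div]
  rw [h]
  fun_prop

/-! ### Separable classical-quantum extensions -/

section Extensions

variable {X Y a b : Type*} [Fintype X] [DecidableEq X] [Fintype Y] [Fintype a] [Fintype b]

/-- The state `∑ q(x,y) |x⟩⟨x| ⊗ σ_A^x ⊗ σ_B^y` of `XAB`, with `Y` traced out. -/
def ensembleState (q : X × Y → ℝ) (σA : X → Matrix a a ℂ) (σB : Y → Matrix b b ℂ) :
    Matrix (X × (a × b)) (X × (a × b)) ℂ :=
  ∑ x, ∑ y, (q (x, y) : ℂ) • (basisProj x ⊗ₖ (σA x ⊗ₖ σB y))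

omit [Fintype a] [Fintype b] in
lemma ensembleState_apply (q : X × Y → ℝ) (σA : X → Matrix a a ℂ) (σB : Y → Matrix b b ℂ)
    (s t : X × (a × b)) :
    ensembleState q σA σB s t = if s.1 = t.1 then
      ∑ y, (q (s.1, y) : ℂ) * (σA s.1 s.2.1 t.2.1 * σB y s.2.2 t.2.2) else 0 := by
  obtain ⟨x, u⟩ := s
  obtain ⟨x', u'⟩ := t
  simp only [ensembleState, Matrix.sum_apply, Matrix.smul_apply, Matrix.kroneckerMap_apply,
    basisProj, Matrix.single_apply, smul_eq_mul]
  rw [Finset.sum_eq_single x (fun x₀ _ h => by simp [h]) (by simp)]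
  by_cases h : x = x' <;> simp [h]

omit [Fintype a] [Fintype b] in
lemma cqState_apply (p : X → ℝ) (ω : X → Matrix (a × b) (a × b) ℂ) (s t : X × (a × b)) :
    cqState p ω s t = if s.1 = t.1 then (p s.1 : ℂ) * ω s.1 s.2 t.2 else 0 := by
  obtain ⟨x, u⟩ := s
  obtain ⟨x', u'⟩ := t
  simp only [cqState, Matrix.sum_apply, Matrix.smul_apply, Matrix.kroneckerMap_apply,
    basisProj, Matrix.single_apply, smul_eq_mul]
  rw [Finset.sum_eq_single x (fun x₀ _ h => by simp [h]) (by simp)]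
  by_cases h : x = x' <;> simp [h]

omit [Fintype a] [Fintype b] in
lemma ensembleState_eq_cqState_iff {q : X × Y → ℝ} {σA : X → Matrix a a ℂ}
    {σB : Y → Matrix b b ℂ} {p : X → ℝ} {ω : X → Matrix (a × b) (a × b) ℂ} :
    ensembleState q σA σB = cqState p ω ↔
      ∀ x, (p x : ℂ) • ω x = ∑ y, (q (x, y) : ℂ) • (σA x ⊗ₖ σB y) := by
  constructor
  · intro h x
    ext u v
    have := congrFun (congrFun h (x, u)) (x, v)
    rw [ensembleState_apply, cqState_apply] at this
    simpa [Matrix.sum_apply] using this.symm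
  · intro h
    ext ⟨x, u⟩ ⟨x', v⟩
    rw [ensembleState_apply, cqState_apply]
    have := congrFun (congrFun (h x) u) v
    by_cases hx : x = x'
    · simpa [hx, Matrix.sum_apply] using this.symm
    · simp [hx]

lemma sum_eq_of_ensembleState_eq {q : X × Y → ℝ} {σA : X → Matrix a a ℂ}
    {σB : Y → Matrix b b ℂ} {p : X → ℝ} {ω : X → Matrix (a × b) (a × b) ℂ}
    (hA : ∀ x, IsDensity (σA x)) (hB : ∀ y, IsDensity (σB y)) (hω : ∀ x, IsDensity (ω x))
    (h : ensembleState q σA σB = cqState p ω) (x : X) : ∑ y, q (x, y) = p x := by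
  have := congrArg Matrix.trace (ensembleState_eq_cqState_iff.1 h x)
  simp only [Matrix.trace_smul, Matrix.trace_sum, Matrix.trace_kronecker, (hω x).2, (hA x).2,
    (hB _).2, smul_eq_mul, mul_one] at this
  exact_mod_cast this.symm

omit [Fintype a] [Fintype b] in
lemma reduceXAB_sum [DecidableEq Y] (q : X × Y → ℝ) (σA : X → Matrix a a ℂ)
    (σB : Y → Matrix b b ℂ) :
    reduceXAB (∑ x, ∑ y, (q (x, y) : ℂ) • (basisProj x ⊗ₖ (basisProj y ⊗ₖ (σA x ⊗ₖ σB y)))) =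
      ensembleState q σA σB := by
  ext ⟨x, u⟩ ⟨x', v⟩
  simp only [reduceXAB, Matrix.of_apply, ensembleState, Matrix.sum_apply, Matrix.smul_apply,
    Matrix.kroneckerMap_apply, smul_eq_mul]
  rw [Finset.sum_comm]
  refine Finset.sum_congr rfl fun x₀ _ => ?_
  rw [Finset.sum_comm]
  refine Finset.sum_congr rfl fun y₀ _ => ?_
  rw [Finset.sum_eq_single y₀ (fun y _ h => by simp [basisProj, h.symm]) (by simp)]
  simp [basisProj]

lemma reduceXY_sum [DecidableEq Y] (q : X × Y → ℝ) {σA : X → Matrix a a ℂ} {σB : Y → Matrix b b ℂ}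
    (hA : ∀ x, IsDensity (σA x)) (hB : ∀ y, IsDensity (σB y)) :
    reduceXY (∑ x, ∑ y, (q (x, y) : ℂ) • (basisProj x ⊗ₖ (basisProj y ⊗ₖ (σA x ⊗ₖ σB y)))) =
      Matrix.diagonal fun z => (q z : ℂ) := by
  have htr : ∀ x y, ∑ v : a × b, σA x v.1 v.1 * σB y v.2 v.2 = 1 := by
    intro x y
    have h := Matrix.trace_kronecker (σA x) (σB y)
    rw [(hA x).2, (hB y).2, one_mul] at h
    exact h
  ext ⟨x, y⟩ ⟨x', y'⟩
  simp only [reduceXY, Matrix.of_apply, Matrix.sum_apply, Matrix.smul_apply,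
    Matrix.kroneckerMap_apply, smul_eq_mul]
  rw [Finset.sum_comm]
  rw [Finset.sum_eq_single x (fun x₀ _ h => by simp [basisProj, h]) (by simp)]
  rw [Finset.sum_comm]
  rw [Finset.sum_eq_single y (fun y₀ _ h => by simp [basisProj, h]) (by simp)]
  simp only [← Finset.mul_sum, htr, Matrix.diagonal_apply, basisProj, Matrix.single_apply,
    Prod.mk.injEq]
  by_cases hx : x = x' <;> by_cases hy : y = y' <;> simp [hx, hy]

lemma mutualInfo_diagonal [DecidableEq Y] (q : X × Y → ℝ) :
    mutualInfo (Matrix.diagonal fun z => (q z : ℂ)) = shannonMutualInfo q := by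
  have hR : traceRight (Matrix.diagonal fun z : X × Y => (q z : ℂ)) =
      Matrix.diagonal fun x => ((∑ y, q (x, y) : ℝ) : ℂ) := by
    ext x x'
    by_cases hx : x = x' <;> simp [traceRight, Matrix.diagonal_apply, hx]
  have hL : traceLeft (Matrix.diagonal fun z : X × Y => (q z : ℂ)) =
      Matrix.diagonal fun y => ((∑ x, q (x, y) : ℝ) : ℂ) := by
    ext y y'
    by_cases hy : y = y' <;> simp [traceLeft, Matrix.diagonal_apply, hy]
  rw [mutualInfo, hR, hL, vonNeumannEntropy_diagonal, vonNeumannEntropy_diagonal,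
    vonNeumannEntropy_diagonal, shannonMutualInfo]

variable {p : X → ℝ} {ω : X → Matrix (a × b) (a × b) ℂ}

lemma exists_ensemble_of_mem_extensions
    {σ : Σ k : ℕ, Matrix (X × (Fin k × (a × b))) (X × (Fin k × (a × b))) ℂ}
    (hσ : σ ∈ extensions p ω) :
    ∃ (q : X × Fin σ.1 → ℝ) (σA : X → Matrix a a ℂ) (σB : Fin σ.1 → Matrix b b ℂ),
      q ∈ stdSimplex ℝ (X × Fin σ.1) ∧ (∀ x, IsDensity (σA x)) ∧ (∀ y, IsDensity (σB y)) ∧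
      ensembleState q σA σB = cqState p ω ∧
      mutualInfo (reduceXY σ.2) = shannonMutualInfo q := by
  obtain ⟨⟨q, σA, σB, hq, hA, hB, hs⟩, hred⟩ := hσ
  refine ⟨q, σA, σB, hq, hA, hB, ?_, ?_⟩
  · rw [← hred, hs, reduceXAB_sum]
  · rw [hs, reduceXY_sum q hA hB, mutualInfo_diagonal]

lemma exists_mem_extensions {q : X × Y → ℝ} {σA : X → Matrix a a ℂ} {σB : Y → Matrix b b ℂ}
    (hq : q ∈ stdSimplex ℝ (X × Y)) (hA : ∀ x, IsDensity (σA x)) (hB : ∀ y, IsDensity (σB y))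
    (h : ensembleState q σA σB = cqState p ω) :
    ∃ σ ∈ extensions p ω, mutualInfo (reduceXY σ.2) = shannonMutualInfo q := by
  let e := (Fintype.equivFin Y).symm
  let q' : X × Fin (Fintype.card Y) → ℝ := fun z => q (z.1, e z.2)
  have hq' : q' ∈ stdSimplex ℝ (X × Fin (Fintype.card Y)) := by
    refine ⟨fun z => hq.1 _, ?_⟩
    rw [← hq.2, Fintype.sum_prod_type, Fintype.sum_prod_type]
    exact Finset.sum_congr rfl fun x _ => e.sum_comp fun y => q (x, y)
  refine ⟨⟨Fintype.card Y, ∑ x, ∑ y, (q' (x, y) : ℂ) •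
    (basisProj x ⊗ₖ (basisProj y ⊗ₖ (σA x ⊗ₖ σB (e y))))⟩,
    ⟨⟨q', σA, fun y => σB (e y), hq', hA, fun y => hB _, rfl⟩, ?_⟩, ?_⟩
  · rw [reduceXAB_sum q' σA fun y => σB (e y), ← h]
    simp only [ensembleState]
    exact Finset.sum_congr rfl fun x _ =>
      e.sum_comp fun y => (q (x, y) : ℂ) • (basisProj x ⊗ₖ (σA x ⊗ₖ σB y))
  · dsimp only
    rw [reduceXY_sum q' hA fun y => hB (e y), mutualInfo_diagonal]
    simp only [shannonMutualInfo, shannonEntropy, q']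
    congr 1
    · congr 1
      · have hx : ∀ x, ∑ y, q (x, e y) = ∑ y, q (x, y) := fun x => e.sum_comp fun y => q (x, y)
        simp only [hx]
      · congr 1
        exact e.sum_comp fun y => (∑ x, q (x, y)) * Real.logb 2 (∑ x, q (x, y))
    · congr 1
      rw [Fintype.sum_prod_type, Fintype.sum_prod_type]
      exact Finset.sum_congr rfl fun x _ => e.sum_comp fun y => q (x, y) * Real.logb 2 (q (x, y))

lemma isSeparable_averageAB (h : (extensions p ω).Nonempty) : IsSeparable (averageAB p ω) := by
  obtain ⟨σ, hσ⟩ := h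
  obtain ⟨q, σA, σB, hq, hA, hB, hs, -⟩ := exists_ensemble_of_mem_extensions hσ
  let e := (Fintype.equivFin (X × Fin σ.1)).symm
  refine ⟨_, fun j => q (e j), fun j => σA (e j).1, fun j => σB (e j).2,
    ⟨fun j => hq.1 _, ?_⟩, fun j => hA _, fun j => hB _, ?_⟩
  · rw [← hq.2]
    exact e.sum_comp q
  · rw [averageAB, Finset.sum_congr rfl fun x _ => ensembleState_eq_cqState_iff.1 hs x,
      ← Fintype.sum_prod_type' fun x y => (q (x, y) : ℂ) • (σA x ⊗ₖ σB y)]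
    exact (e.sum_comp fun z => (q z : ℂ) • (σA z.1 ⊗ₖ σB z.2)).symm

end Extensions

/-! ### The average state of a code -/

lemma sum_prod_eq_one {ι : Type*} [Fintype ι] {n : ℕ} {r : Fin n → ι → ℝ}
    (hr : ∀ i, ∑ x, r i x = 1) : ∑ x : Fin n → ι, ∏ i, r i (x i) = 1 := by
  rw [← Fintype.prod_sum r]
  exact Finset.prod_eq_one fun i _ => hr i

lemma sum_prod_mul_apply {ι : Type*} [Fintype ι] {n : ℕ} {p : ι → ℝ} (hp : ∑ x, p x = 1)
    (i : Fin n) (g : ι → ℝ) :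
    ∑ x : Fin n → ι, (∏ j, p (x j)) * g (x i) = ∑ x, p x * g x := by
  let F : Fin n → ι → ℝ := fun j v => p v * if j = i then g v else 1
  have hF : ∀ x : Fin n → ι, (∏ j, p (x j)) * g (x i) = ∏ j, F j (x j) := by
    intro x
    simp only [F, Finset.prod_mul_distrib]
    simp
  rw [Finset.sum_congr rfl fun x _ => hF x, ← Fintype.prod_sum F, Finset.prod_eq_single i]
  · simp [F]
  · intro j _ hj
    simp [F, hj, hp]
  · simp

section Code

variable {X Y a b : Type*} [Fintype X] [DecidableEq X] [Fintype Y] [DecidableEq Y]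
  [Fintype a] [DecidableEq a] [Fintype b] [DecidableEq b] {n M : ℕ}

/-- The joint distribution of the source letter `X_I` and the label `y I m`, where the position `I`
is uniform on the block and `m` is the message. -/
def Code.labelDist (p : X → ℝ) (c : Code X a b n M) (y : Fin n → Fin M → Y) (z : X × Y) : ℝ :=
  1 / (n : ℝ) * ∑ i, ∑ x : Fin n → X, ∑ m,
    if (x i, y i m) = z then (∏ j, p (x j)) * c.enc x m else 0

lemma Code.averageState_eq_ensembleState (p : X → ℝ) (c : Code X a b n M)
    (y : Fin n → Fin M → Y) {σB : Y → Matrix b b ℂ}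
    (hσ : ∀ i m, marginal i (c.bob m) = σB (y i m)) :
    c.averageState p = ensembleState (c.labelDist p y) c.alice σB := by
  have hA : ∀ (x : Fin n → X) i, marginal i (c.aliceState x) = c.alice (x i) := fun x i =>
    marginal_tensorPi (fun j => (c.alice_density (x j)).2) i
  simp only [averageState, ensembleState, hA, hσ]
  rw [← Fintype.sum_prod_type' fun x₀ y₀ =>
    (c.labelDist p y (x₀, y₀) : ℂ) • (basisProj x₀ ⊗ₖ (c.alice x₀ ⊗ₖ σB y₀))]
  simp only [labelDist]
  push_cast
  simp only [Finset.sum_smul, Finset.smul_sum, mul_smul, Finset.mul_sum]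
  symm
  rw [Finset.sum_comm]
  refine Finset.sum_congr rfl fun i _ => ?_
  rw [Finset.sum_comm]
  refine Finset.sum_congr rfl fun x _ => ?_
  rw [Finset.sum_comm]
  refine Finset.sum_congr rfl fun m _ => ?_
  rw [Finset.sum_eq_single (x i, y i m)]
  · simp [mul_smul]
  · intro z _ hz
    simp [Ne.symm hz]
  · simp

end Code

/-! ### Single-letter bound on the number of messages -/

section Converse

variable {X a b : Type*} [Fintype X] [DecidableEq X] [Fintype a] [Fintype b] {n M : ℕ}

/-- `∑ᵢ I(Xᵢ;m) ≤ log M`: the left side is the mean of the logarithm of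
`∏ᵢ P(xᵢ|m) / p(xᵢ)`, and this ratio has mean at most `M`, because `P(m|xⁿ) ≤ 1`. -/
lemma Code.exists_conditional (p : X → ℝ) (hp : p ∈ stdSimplex ℝ X) (c : Code X a b n M)
    (hn : 0 < n) (hM : 0 < M) :
    ∃ (w : Fin n × Fin M → ℝ) (r : Fin n × Fin M → X → ℝ),
      w ∈ stdSimplex ℝ (Fin n × Fin M) ∧ (∀ y, r y ∈ stdSimplex ℝ X) ∧
      c.labelDist p Prod.mk = (fun z => w z.2 * r z.2 z.1) ∧
      shannonEntropy p - 1 / (n : ℝ) * Real.logb 2 M ≤ ∑ y, w y * shannonEntropy (r y) := by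
  have hn' : (0 : ℝ) < n := by exact_mod_cast hn
  have he0 : ∀ x m, 0 ≤ c.enc x m := fun x m => (c.enc_mem x).1 m
  have he1 : ∀ x m, c.enc x m ≤ 1 := fun x m =>
    (Finset.single_le_sum (fun m _ => he0 x m) (Finset.mem_univ m)).trans (c.enc_mem x).2.le
  have hp0 : ∀ x : Fin n → X, 0 ≤ ∏ j, p (x j) := fun x => Finset.prod_nonneg fun j _ => hp.1 _
  let J : (Fin n → X) → Fin M → ℝ := fun x m => (∏ j, p (x j)) * c.enc x m
  have hJ0 : ∀ x m, 0 ≤ J x m := fun x m => mul_nonneg (hp0 x) (he0 x m)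
  have hJX : ∀ x, ∑ m, J x m = ∏ j, p (x j) := fun x => by
    simp only [J, ← Finset.mul_sum, (c.enc_mem x).2, mul_one]
  have hJ1 : ∑ x, ∑ m, J x m = 1 := by
    simp only [hJX]
    exact sum_prod_eq_one (r := fun _ => p) fun _ => hp.2
  let Pm : Fin M → ℝ := fun m => ∑ x, J x m
  have hPm0 : ∀ m, 0 ≤ Pm m := fun m => Finset.sum_nonneg fun x _ => hJ0 x m
  let Pi : Fin n × Fin M → X → ℝ := fun y x₀ => ∑ x : Fin n → X, if x y.1 = x₀ then J x y.2 else 0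
  have hPi0 : ∀ y x₀, 0 ≤ Pi y x₀ := fun y x₀ => Finset.sum_nonneg fun x _ => by
    split_ifs
    exacts [hJ0 _ _, le_rfl]
  have hJPi : ∀ x m i, J x m ≤ Pi (i, m) (x i) := by
    intro x m i
    have := Finset.single_le_sum (f := fun x' : Fin n → X => if x' i = x i then J x' m else 0)
      (fun x' _ => by
        split_ifs
        exacts [hJ0 _ _, le_rfl]) (Finset.mem_univ x)
    simpa [Pi] using this
  have hPi1 : ∀ y, ∑ x₀, Pi y x₀ = Pm y.2 := fun y => by
    simp only [Pi, Pm]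
    rw [Finset.sum_comm]
    simp
  have hPig : ∀ y (g : X → ℝ), ∑ x₀, Pi y x₀ * g x₀ = ∑ x : Fin n → X, J x y.2 * g (x y.1) := by
    intro y g
    simp only [Pi, Finset.sum_mul]
    rw [Finset.sum_comm]
    simp
  -- on messages of probability zero any conditional distribution will do
  let r : Fin n × Fin M → X → ℝ := fun y => if Pm y.2 = 0 then p else fun x₀ => Pi y x₀ / Pm y.2
  have hr : ∀ y, r y ∈ stdSimplex ℝ X := by
    intro y
    by_cases h : Pm y.2 = 0
    · simpa [r, h] using hp
    · simp only [r, h, if_false]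
      refine ⟨fun x₀ => div_nonneg (hPi0 _ _) (hPm0 _), ?_⟩
      rw [← Finset.sum_div, hPi1, div_self h]
  have hmul : ∀ y x₀, Pm y.2 * r y x₀ = Pi y x₀ := by
    intro y x₀
    by_cases h : Pm y.2 = 0
    · rw [h, zero_mul]
      have hz := (Finset.sum_eq_zero_iff_of_nonneg fun x₀ _ => hPi0 y x₀).1 ((hPi1 y).trans h)
      exact (hz x₀ (Finset.mem_univ _)).symm
    · simp only [r, h, if_false]
      exact mul_div_cancel₀ _ h
  refine ⟨fun y => 1 / (n : ℝ) * Pm y.2, r, ⟨fun y => ?_, ?_⟩, hr, ?_, ?_⟩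
  · exact mul_nonneg (by positivity) (hPm0 _)
  · rw [← Finset.mul_sum, Fintype.sum_prod_type]
    simp only [Pm]
    rw [Finset.sum_comm' (t' := Finset.univ) (s' := fun _ => Finset.univ) (by simp)]
    have : ∑ m, ∑ x, J x m = 1 := by rw [Finset.sum_comm, hJ1]
    simp [this, Finset.sum_const, ← Finset.mul_sum, hn'.ne']
  · funext ⟨x₀, i₀, m₀⟩
    rw [mul_assoc, hmul]
    simp only [labelDist, Pi]
    congr 1
    rw [Finset.sum_eq_single i₀ (fun i _ hi => by simp [hi]) (by simp)]
    refine Finset.sum_congr rfl fun x _ => ?_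
    rw [Finset.sum_eq_single m₀ (fun m _ hm => by simp [hm]) (by simp)]
    simp [J]
  · -- the single application of Jensen's inequality
    have hJens := sum_mul_logb_le (w := fun z : (Fin n → X) × Fin M => J z.1 z.2)
      (a := fun z => ∏ i, (r (i, z.2) (z.1 i) / p (z.1 i))) (c := M)
      ⟨fun z => hJ0 _ _, by rw [Fintype.sum_prod_type, hJ1]⟩ ?_ (by exact_mod_cast hM) ?_
    · have hlog : ∀ z : (Fin n → X) × Fin M,
          J z.1 z.2 * Real.logb 2 (∏ i, (r (i, z.2) (z.1 i) / p (z.1 i))) =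
          ∑ i, (J z.1 z.2 * Real.logb 2 (r (i, z.2) (z.1 i)) -
            J z.1 z.2 * Real.logb 2 (p (z.1 i))) := by
        rintro ⟨x, m⟩
        rcases (hJ0 x m).eq_or_lt with h0 | h0
        · simp [← h0]
        · have hpx : ∀ i, p (x i) ≠ 0 := fun i =>
            Finset.prod_ne_zero_iff.1 (left_ne_zero_of_mul h0.ne') i (Finset.mem_univ i)
          have hrx : ∀ i, r (i, m) (x i) ≠ 0 := by
            intro i hri
            have h1 : Pi (i, m) (x i) = 0 := by rw [← hmul, hri, mul_zero]
            have h2 := hJPi x m i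
            linarith
          rw [Real.logb_prod _ _ fun i _ => div_ne_zero (hrx i) (hpx i), Finset.mul_sum]
          refine Finset.sum_congr rfl fun i _ => ?_
          rw [Real.logb_div (hrx i) (hpx i), mul_sub]
      rw [Finset.sum_congr rfl fun z _ => hlog z, Finset.sum_comm] at hJens
      simp only [Finset.sum_sub_distrib] at hJens
      have h1 : ∀ i : Fin n, ∑ z : (Fin n → X) × Fin M, J z.1 z.2 * Real.logb 2 (p (z.1 i)) =
          -shannonEntropy p := by
        intro i
        rw [Fintype.sum_prod_type]
        simp only [← Finset.sum_mul, hJX]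
        rw [sum_prod_mul_apply hp.2 i fun v => Real.logb 2 (p v), shannonEntropy, neg_neg]
      have h2 : ∑ i : Fin n, ∑ z : (Fin n → X) × Fin M,
          J z.1 z.2 * Real.logb 2 (r (i, z.2) (z.1 i)) =
          -∑ y : Fin n × Fin M, Pm y.2 * shannonEntropy (r y) := by
        rw [Fintype.sum_prod_type, ← Finset.sum_neg_distrib]
        refine Finset.sum_congr rfl fun i _ => ?_
        rw [Fintype.sum_prod_type_right, ← Finset.sum_neg_distrib]
        refine Finset.sum_congr rfl fun m _ => ?_
        rw [shannonEntropy, mul_neg, neg_neg, Finset.mul_sum,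
          ← hPig (i, m) fun v => Real.logb 2 (r (i, m) v)]
        refine Finset.sum_congr rfl fun v _ => ?_
        rw [← hmul, mul_assoc]
      simp only [h1, h2, Finset.sum_const, Finset.card_univ, Fintype.card_fin, nsmul_eq_mul]
        at hJens
      simp only [mul_assoc, ← Finset.mul_sum]
      have hS : shannonEntropy p = 1 / (n : ℝ) * (n * shannonEntropy p) := by field_simp
      rw [hS, ← mul_sub]
      gcongr
      linarith
    · rintro ⟨x, m⟩ h0
      refine Finset.prod_pos fun i _ => ?_
      have hpx : 0 < p (x i) := (hp.1 _).lt_of_ne' <|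
        Finset.prod_ne_zero_iff.1 (left_ne_zero_of_mul h0.ne') i (Finset.mem_univ i)
      have h2 := hJPi x m i
      have hrx : 0 < r (i, m) (x i) := by
        refine ((hr (i, m)).1 _).lt_of_ne' fun hri => ?_
        have h1 : Pi (i, m) (x i) = 0 := by rw [← hmul, hri, mul_zero]
        have h0' : 0 < J x m := h0
        linarith
      exact div_pos hrx hpx
    · have hle : ∀ z : (Fin n → X) × Fin M,
          J z.1 z.2 * ∏ i, (r (i, z.2) (z.1 i) / p (z.1 i)) ≤ ∏ i, r (i, z.2) (z.1 i) := by
        rintro ⟨x, m⟩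
        have hR : 0 ≤ ∏ i, r (i, m) (x i) := Finset.prod_nonneg fun i _ => (hr _).1 _
        dsimp only [J]
        rw [Finset.prod_div_distrib]
        by_cases h0 : ∏ i, p (x i) = 0
        · simpa [h0] using hR
        · calc _ = c.enc x m * ∏ i, r (i, m) (x i) := by field_simp
            _ ≤ 1 * ∏ i, r (i, m) (x i) := by gcongr; exact he1 x m
            _ = _ := one_mul _
      calc _ ≤ ∑ z : (Fin n → X) × Fin M, ∏ i, r (i, z.2) (z.1 i) :=
            Finset.sum_le_sum fun z _ => hle z
        _ = ∑ m : Fin M, 1 := by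
            rw [Fintype.sum_prod_type_right]
            exact Finset.sum_congr rfl fun m _ =>
              sum_prod_eq_one (r := fun i => r (i, m)) fun i => (hr _).2
        _ = M := by simp

end Converse

/-! ### Compactness of the set of single-letter ensembles -/

section Compactness

variable {X a b : Type*} [Fintype X] [DecidableEq X] [Fintype a] [DecidableEq a] [Fintype b]
  [DecidableEq b]

open scoped MatrixOrder in
lemma norm_apply_le_one_of_isDensity {ρ : Matrix b b ℂ} (h : IsDensity ρ) (i j : b) :
    ‖ρ i j‖ ≤ 1 := by
  obtain ⟨B, hB⟩ := CStarAlgebra.nonneg_iff_eq_star_mul_self.mp h.1.nonneg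
  have hentry : ∀ i j, ρ i j = ∑ k, star (B k i) * B k j := by
    intro i j
    rw [hB]
    rfl
  have htr : ∑ k, ∑ l, ‖B k l‖ ^ 2 = 1 := by
    have h1 := h.2
    simp only [Matrix.trace, Matrix.diag, hentry] at h1
    rw [Finset.sum_comm] at h1
    have h2 : ∀ k l, star (B k l) * B k l = ((‖B k l‖ ^ 2 : ℝ) : ℂ) := fun k l => by
      simpa using Complex.conj_mul' (B k l)
    simp only [h2] at h1
    exact_mod_cast h1
  have hle : ∀ k l, ‖B k l‖ ^ 2 ≤ ∑ l, ‖B k l‖ ^ 2 := fun k l =>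
    Finset.single_le_sum (f := fun l => ‖B k l‖ ^ 2) (fun _ _ => by positivity)
      (Finset.mem_univ l)
  calc ‖ρ i j‖ = ‖∑ k, star (B k i) * B k j‖ := by rw [hentry]
    _ ≤ ∑ k, ‖star (B k i) * B k j‖ := norm_sum_le _ _
    _ ≤ ∑ k, ∑ l, ‖B k l‖ ^ 2 := by
        refine Finset.sum_le_sum fun k _ => ?_
        rw [norm_mul, norm_star]
        nlinarith [hle k i, hle k j, sq_nonneg (‖B k i‖ - ‖B k j‖)]
    _ = 1 := htr

lemma isCompact_isDensity : IsCompact {ρ : Matrix b b ℂ | IsDensity ρ} := by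
  have hbox : IsCompact (Set.univ.pi fun _ : b => Set.univ.pi fun _ : b =>
      Metric.closedBall (0 : ℂ) 1) :=
    isCompact_univ_pi fun _ => isCompact_univ_pi fun _ => isCompact_closedBall _ _
  refine IsCompact.of_isClosed_subset hbox ?_ ?_
  · have hset : {ρ : Matrix b b ℂ | IsDensity ρ} =
        {ρ | ρ.conjTranspose = ρ} ∩ (⋂ x : b → ℂ, {ρ | 0 ≤ star x ⬝ᵥ ρ.mulVec x}) ∩
          {ρ | ρ.trace = 1} := by
      ext ρ
      simp only [IsDensity, Matrix.posSemidef_iff_dotProduct_mulVec, Matrix.IsHermitian,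
        Set.mem_ofPred_eq, Set.mem_inter_iff, Set.mem_iInter]
    rw [hset]
    refine (IsClosed.inter ?_ ?_).inter ?_
    · exact isClosed_eq (by fun_prop) continuous_id
    · refine isClosed_iInter fun x => isClosed_le continuous_const ?_
      fun_prop
    · exact isClosed_eq (by fun_prop) continuous_const
  · intro ρ h i _ j _
    simpa using norm_apply_le_one_of_isDensity h i j

/-- The pairs of the operators `x ↦ P(x) σ` on `XB` and the entropy of `P`, for a distribution `P`
of `X` and a state `σ` of `B`. Their convex combinations describe the ensembles in which `P` and
`σ` depend on a label `y`: they determine the reduced state on `XB` and `H(X|Y)`. -/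
def labelPoints (X b : Type*) [Fintype X] [Fintype b] : Set ((X → Matrix b b ℂ) × ℝ) :=
  (fun z : (X → ℝ) × Matrix b b ℂ => (fun x => z.1 x • z.2, shannonEntropy z.1)) ''
    (stdSimplex ℝ X ×ˢ {ρ | IsDensity ρ})

omit [DecidableEq X] in
lemma isCompact_labelPoints : IsCompact (labelPoints X b) := by
  refine ((isCompact_stdSimplex ℝ X).prod isCompact_isDensity).image ?_
  refine Continuous.prodMk ?_ (continuous_shannonEntropy.comp continuous_fst)
  fun_prop

/-- The operator `∑ₓ |x⟩⟨x| ⊗ σ_A^x ⊗ τ_x`. -/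
def blockState (σA : X → Matrix a a ℂ) (τ : X → Matrix b b ℂ) :
    Matrix (X × (a × b)) (X × (a × b)) ℂ :=
  ∑ x, basisProj x ⊗ₖ (σA x ⊗ₖ τ x)

omit [Fintype a] [DecidableEq a] [Fintype b] [DecidableEq b] in
lemma ensembleState_mul {Y : Type*} [Fintype Y] (w : Y → ℝ) (r : Y → X → ℝ)
    (σA : X → Matrix a a ℂ) (σB : Y → Matrix b b ℂ) :
    ensembleState (fun z => w z.2 * r z.2 z.1) σA σB =
      blockState σA (∑ y, w y • fun x => r y x • σB y) := by
  ext s t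
  simp only [ensembleState, blockState, Matrix.sum_apply, Matrix.smul_apply, Finset.sum_apply,
    Matrix.kroneckerMap_apply, Pi.smul_apply, Finset.mul_sum]
  refine Finset.sum_congr rfl fun x _ => Finset.sum_congr rfl fun y _ => ?_
  simp only [Complex.real_smul, smul_eq_mul, Complex.ofReal_mul]
  ring

omit [DecidableEq a] [DecidableEq b] in
/-- Approximate ensembles with bounded conditional entropy yield an exact one, by compactness. -/
lemma exists_blockState_eq {ρ₀ : Matrix (X × (a × b)) (X × (a × b)) ℂ} {h₀ : ℝ}
    (happrox : ∀ ε > 0, ∃ σA : X → Matrix a a ℂ, (∀ x, IsDensity (σA x)) ∧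
      ∃ v ∈ convexHull ℝ (labelPoints X b),
        (∀ s t, ‖(blockState σA v.1 - ρ₀) s t‖ ≤ ε) ∧ h₀ - ε ≤ v.2) :
    ∃ σA : X → Matrix a a ℂ, (∀ x, IsDensity (σA x)) ∧
      ∃ v ∈ convexHull ℝ (labelPoints X b), blockState σA v.1 = ρ₀ ∧ h₀ ≤ v.2 := by
  classical
  let S : Set ((X → Matrix a a ℂ) × ((X → Matrix b b ℂ) × ℝ)) :=
    (Set.univ.pi fun _ => {ρ | IsDensity ρ}) ×ˢ convexHull ℝ (labelPoints X b)
  have hS : IsCompact S :=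
    (isCompact_univ_pi fun _ => isCompact_isDensity).prod
      (isCompact_convexHull isCompact_labelPoints)
  let f : (X → Matrix a a ℂ) × ((X → Matrix b b ℂ) × ℝ) → ℝ := fun z =>
    max (∑ s, ∑ t, ‖(blockState z.1 z.2.1 - ρ₀) s t‖) (h₀ - z.2.2)
  have hf : Continuous f := by
    refine Continuous.max ?_ (by fun_prop)
    refine continuous_finsetSum _ fun s _ => continuous_finsetSum _ fun t _ => ?_
    simp only [blockState, Matrix.sub_apply, Matrix.sum_apply, Matrix.kroneckerMap_apply]
    refine Continuous.norm (Continuous.sub (continuous_finsetSum _ fun x _ => ?_) continuous_const)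
    refine continuous_const.mul (Continuous.mul ?_ ?_)
    · exact ((continuous_apply x).comp continuous_fst).matrix_elem _ _
    · exact ((continuous_apply x).comp (continuous_fst.comp continuous_snd)).matrix_elem _ _
  have hne : S.Nonempty := by
    obtain ⟨σA, hA, v, hv, -⟩ := happrox 1 one_pos
    exact ⟨(σA, v), fun x _ => hA x, hv⟩
  obtain ⟨z, hzS, hmin⟩ := hS.exists_isMinOn hne hf.continuousOn
  let C : ℝ := (Fintype.card (X × (a × b)) : ℝ) * Fintype.card (X × (a × b)) + 1
  have hC : 0 < C := by positivity
  have hle : ∀ ε > 0, f z ≤ C * ε := by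
    intro ε hε
    obtain ⟨σA, hA, v, hv, h1, h2⟩ := happrox ε hε
    have hz : f z ≤ f (σA, v) := hmin (show (σA, v) ∈ S from ⟨fun x _ => hA x, hv⟩)
    refine hz.trans (max_le ?_ ?_)
    · calc ∑ s, ∑ t, ‖(blockState σA v.1 - ρ₀) s t‖
          ≤ ∑ _s : X × (a × b), ∑ _t : X × (a × b), ε :=
            Finset.sum_le_sum fun s _ => Finset.sum_le_sum fun t _ => h1 s t
        _ = (C - 1) * ε := by
            simp only [Finset.sum_const, Finset.card_univ, nsmul_eq_mul, C]
            ring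
        _ ≤ C * ε := by nlinarith
    · have hC1 : 1 ≤ C := by
        have : (0 : ℝ) ≤ (Fintype.card (X × (a × b)) : ℝ) * Fintype.card (X × (a × b)) := by
          positivity
        linarith
      dsimp only
      nlinarith
  have h0 : f z ≤ 0 := by
    by_contra! hpos
    have := hle (f z / (2 * C)) (by positivity)
    have h2 : C * (f z / (2 * C)) = f z / 2 := by field_simp
    linarith
  refine ⟨z.1, fun x => hzS.1 x trivial, z.2, hzS.2, ?_, ?_⟩
  · have hsum : ∑ s, ∑ t, ‖(blockState z.1 z.2.1 - ρ₀) s t‖ ≤ 0 := (le_max_left _ _).trans h0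
    ext s t
    have h1 : ‖(blockState z.1 z.2.1 - ρ₀) s t‖ ≤ ∑ t, ‖(blockState z.1 z.2.1 - ρ₀) s t‖ :=
      Finset.single_le_sum (f := fun t => ‖(blockState z.1 z.2.1 - ρ₀) s t‖)
        (fun _ _ => norm_nonneg _) (Finset.mem_univ t)
    have h2 : ∑ t, ‖(blockState z.1 z.2.1 - ρ₀) s t‖ ≤
        ∑ s, ∑ t, ‖(blockState z.1 z.2.1 - ρ₀) s t‖ :=
      Finset.single_le_sum (f := fun s => ∑ t, ‖(blockState z.1 z.2.1 - ρ₀) s t‖)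
        (fun _ _ => Finset.sum_nonneg fun _ _ => norm_nonneg _) (Finset.mem_univ s)
    have h3 : (blockState z.1 z.2.1 - ρ₀) s t = 0 := norm_le_zero_iff.1 (by linarith)
    exact sub_eq_zero.1 h3
  · have := (le_max_right _ _).trans h0
    linarith

/-- Converse part of the coding theorem: an achievable rate is at least the mutual information of
some extension. The ensembles induced by codes with vanishing error and excess rate are points of
one compact set, whatever the block length, so they accumulate at an exact ensemble. -/
theorem Achievable.exists_mutualInfo_le {p : X → ℝ} (hp : p ∈ stdSimplex ℝ X)
    {ω : X → Matrix (a × b) (a × b) ℂ} (hω : ∀ x, IsDensity (ω x)) {R : ℝ}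
    (hR : Achievable p ω R) : ∃ σ ∈ extensions p ω, mutualInfo (reduceXY σ.2) ≤ R := by
  obtain ⟨σA, hA, v, hv, hv1, hv2⟩ :=
      exists_blockState_eq (a := a) (b := b) (ρ₀ := cqState p ω) (h₀ := shannonEntropy p - R) <| by
    intro ε hε
    obtain ⟨N, hN⟩ := hR.2 ε hε ε hε
    have hn : 0 < max N 1 := by positivity
    obtain ⟨c, hc⟩ := hN (max N 1) (le_max_left _ _)
    generalize max N 1 = n at hn c hc
    have hn' : (0 : ℝ) < n := by exact_mod_cast hn
    have h1M : 1 ≤ (2 : ℝ) ^ ((n : ℝ) * (R + ε)) :=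
      Real.one_le_rpow one_le_two (mul_nonneg hn'.le (by linarith [hR.1]))
    have hM : 0 < ⌊(2 : ℝ) ^ ((n : ℝ) * (R + ε))⌋₊ := Nat.floor_pos.2 h1M
    obtain ⟨w, r, hw, hr, hq, hent⟩ := c.exists_conditional p hp hn hM
    have hB : ∀ y : Fin n × Fin ⌊(2 : ℝ) ^ ((n : ℝ) * (R + ε))⌋₊,
        IsDensity (marginal y.1 (c.bob y.2)) := fun y => isDensity_marginal _ (c.bob_density _)
    refine ⟨c.alice, c.alice_density,
      ∑ y, w y • (fun x => r y x • marginal y.1 (c.bob y.2), shannonEntropy (r y)), ?_, ?_, ?_⟩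
    · exact mem_convexHull_of_exists_fintype w _ hw.1 hw.2
        (fun y => ⟨(r y, _), ⟨hr y, hB y⟩, rfl⟩) rfl
    · intro s t
      have hs : c.averageState p = blockState c.alice
          (∑ y, w y • fun x => r y x • marginal y.1 (c.bob y.2)) := by
        rw [← ensembleState_mul, ← hq]
        exact c.averageState_eq_ensembleState p Prod.mk
          (σB := fun y => marginal y.1 (c.bob y.2)) fun i m => rfl
      rw [Prod.fst_sum]
      simp only [Prod.smul_fst]
      rw [← hs]
      exact (norm_apply_le_traceNorm _ s t).trans hc
    · rw [Prod.snd_sum]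
      simp only [Prod.smul_snd, smul_eq_mul]
      refine le_trans ?_ hent
      have hlog : Real.logb 2 (⌊(2 : ℝ) ^ ((n : ℝ) * (R + ε))⌋₊ : ℝ) ≤ n * (R + ε) := by
        rw [Real.logb_le_iff_le_rpow one_lt_two (by exact_mod_cast hM)]
        exact Nat.floor_le (by positivity)
      have : 1 / (n : ℝ) * Real.logb 2 (⌊(2 : ℝ) ^ ((n : ℝ) * (R + ε))⌋₊ : ℝ) ≤ R + ε := by
        calc _ ≤ 1 / (n : ℝ) * (n * (R + ε)) := by gcongr
          _ = _ := by field_simp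
      linarith
  obtain ⟨ι, _, w, z, hw0, hw1, hz, hsum⟩ := mem_convexHull_iff_exists_fintype.1 hv
  choose u hu huz using hz
  obtain rfl : (fun y => ((fun x => (u y).1 x • (u y).2), shannonEntropy (u y).1)) = z := funext huz
  subst hsum
  rw [Prod.fst_sum] at hv1
  rw [Prod.snd_sum] at hv2
  simp only [Prod.smul_fst, Prod.smul_snd, smul_eq_mul] at hv1 hv2
  rw [← ensembleState_mul w fun y => (u y).1] at hv1
  have hB : ∀ y, IsDensity (u y).2 := fun y => (hu y).2
  have hq : (fun z : X × ι => w z.2 * (u z.2).1 z.1) ∈ stdSimplex ℝ (X × ι) := by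
    refine ⟨fun z => mul_nonneg (hw0 _) ((hu _).1.1 _), ?_⟩
    rw [Fintype.sum_prod_type_right, ← hw1]
    refine Finset.sum_congr rfl fun y _ => ?_
    dsimp only
    rw [← Finset.mul_sum, (hu y).1.2, mul_one]
  obtain ⟨σ, hσ, hI⟩ := exists_mem_extensions hq hA hB hv1
  refine ⟨σ, hσ, ?_⟩
  rw [hI, shannonMutualInfo_mul w (fun y => (u y).1) fun y => (hu y).1]
  have hpx : (fun x => ∑ y, w y * (u y).1 x) = p :=
    funext fun x => sum_eq_of_ensembleState_eq hA hB hω hv1 x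
  rw [hpx]
  linarith

end Compactness

/-! ### Typical sequences -/

section Typical

variable {Z : Type*} [Fintype Z] [DecidableEq Z] {n : ℕ}

/-- The relative frequency of a letter in a sequence. -/
def empirical (z : Fin n → Z) (z₀ : Z) : ℝ :=
  1 / (n : ℝ) * ∑ i, if z i = z₀ then 1 else 0

/-- All relative frequencies are within `δ` of the prescribed probabilities. -/
def IsTypical (q : Z → ℝ) (δ : ℝ) (z : Fin n → Z) : Prop :=
  ∀ z₀, |empirical z z₀ - q z₀| ≤ δ

omit [Fintype Z] in
lemma empirical_nonneg (z : Fin n → Z) (z₀ : Z) : 0 ≤ empirical z z₀ :=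
  mul_nonneg (by positivity) (Finset.sum_nonneg fun i _ => by split_ifs <;> norm_num)

omit [Fintype Z] in
lemma empirical_le_one (z : Fin n → Z) (z₀ : Z) : empirical z z₀ ≤ 1 := by
  have h : ∑ i, (if z i = z₀ then (1 : ℝ) else 0) ≤ n := by
    calc _ ≤ ∑ _i : Fin n, (1 : ℝ) := Finset.sum_le_sum fun i _ => by split_ifs <;> norm_num
      _ = n := by simp
  rw [empirical, one_div_mul_eq_div]
  exact div_le_one_of_le₀ h (by positivity)

lemma sum_empirical_mul (z : Fin n → Z) (g : Z → ℝ) :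
    ∑ z₀, empirical z z₀ * g z₀ = 1 / (n : ℝ) * ∑ i, g (z i) := by
  simp only [empirical, mul_assoc, Finset.sum_mul, ← Finset.mul_sum]
  rw [Finset.sum_comm]
  simp

omit [DecidableEq Z] in
lemma sum_prod_mul_sq_sum {q : Z → ℝ} (hq : ∑ z, q z = 1) {g : Z → ℝ}
    (hg : ∑ z, q z * g z = 0) :
    ∑ z : Fin n → Z, (∏ j, q (z j)) * (∑ i, g (z i)) ^ 2 = n * ∑ z, q z * g z ^ 2 := by
  have hcross : ∀ i k : Fin n, i ≠ k →
      ∑ z : Fin n → Z, (∏ j, q (z j)) * (g (z i) * g (z k)) = 0 := by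
    intro i k hik
    let F : Fin n → Z → ℝ := fun j v =>
      q v * ((if j = i then g v else 1) * if j = k then g v else 1)
    have hF : ∀ z : Fin n → Z, (∏ j, q (z j)) * (g (z i) * g (z k)) = ∏ j, F j (z j) := by
      intro z
      simp only [F, Finset.prod_mul_distrib]
      simp
    rw [Finset.sum_congr rfl fun z _ => hF z, ← Fintype.prod_sum F]
    exact Finset.prod_eq_zero (Finset.mem_univ i) (by simpa [F, hik] using hg)
  have hdiag : ∀ i : Fin n, ∑ z : Fin n → Z, (∏ j, q (z j)) * (g (z i) * g (z i)) =
      ∑ z, q z * g z ^ 2 := by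
    intro i
    simp only [← pow_two]
    exact sum_prod_mul_apply hq i fun v => g v ^ 2
  have hexp : ∀ z : Fin n → Z, (∏ j, q (z j)) * (∑ i, g (z i)) ^ 2 =
      ∑ i, ∑ k, (∏ j, q (z j)) * (g (z i) * g (z k)) := by
    intro z
    rw [pow_two, Finset.sum_mul_sum]
    simp only [Finset.mul_sum]
  rw [Finset.sum_congr rfl fun z _ => hexp z, Finset.sum_comm]
  have hrow : ∀ i : Fin n, ∑ z : Fin n → Z, ∑ k, (∏ j, q (z j)) * (g (z i) * g (z k)) =
      ∑ z, q z * g z ^ 2 := by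
    intro i
    rw [Finset.sum_comm, Finset.sum_eq_single i (fun k _ hk => hcross i k hk.symm) (by simp),
      hdiag i]
  simp only [hrow]
  simp

open Classical in
/-- Chebyshev's inequality for the relative frequencies of an i.i.d. sequence. -/
lemma sum_not_isTypical_le {q : Z → ℝ} (hq : q ∈ stdSimplex ℝ Z) {δ : ℝ} (hδ : 0 < δ)
    (hn : 0 < n) :
    ∑ z : Fin n → Z, (∏ j, q (z j)) * (if IsTypical q δ z then 0 else 1) ≤
      Fintype.card Z / (n * δ ^ 2) := by
  have hn' : (0 : ℝ) < n := by exact_mod_cast hn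
  let g : Z → Z → ℝ := fun z₀ v => (if v = z₀ then 1 else 0) - q z₀
  have hdev : ∀ (z : Fin n → Z) z₀, ∑ i, g z₀ (z i) = n * (empirical z z₀ - q z₀) := by
    intro z z₀
    simp only [g, Finset.sum_sub_distrib, empirical, Finset.sum_const, Finset.card_univ,
      Fintype.card_fin, nsmul_eq_mul]
    field_simp
  have hpt : ∀ z : Fin n → Z, (if IsTypical q δ z then (0 : ℝ) else 1) ≤
      ∑ z₀, (∑ i, g z₀ (z i)) ^ 2 / (n * δ) ^ 2 := by
    intro z
    split_ifs with h
    · exact Finset.sum_nonneg fun _ _ => by positivity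
    · simp only [IsTypical, not_forall, not_le] at h
      obtain ⟨z₀, hz₀⟩ := h
      refine le_trans ?_ (Finset.single_le_sum
        (f := fun z₀ => (∑ i, g z₀ (z i)) ^ 2 / (n * δ) ^ 2) (fun _ _ => by positivity)
        (Finset.mem_univ z₀))
      rw [hdev, mul_pow, mul_pow, mul_div_mul_left _ _ (by positivity), ← sq_abs,
        one_le_div (by positivity)]
      gcongr
  have hvar : ∀ z₀, ∑ z : Fin n → Z, (∏ j, q (z j)) * (∑ i, g z₀ (z i)) ^ 2 ≤ n := by
    intro z₀
    have hq1 : q z₀ ≤ 1 := (Finset.single_le_sum (fun z _ => hq.1 z) (Finset.mem_univ z₀)).trans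
      hq.2.le
    rw [sum_prod_mul_sq_sum hq.2]
    · have : ∑ z, q z * g z₀ z ^ 2 ≤ 1 := by
        rw [← hq.2]
        refine Finset.sum_le_sum fun z _ => mul_le_of_le_one_right (hq.1 z) ?_
        have := hq.1 z₀
        simp only [g]
        split_ifs <;> nlinarith
      nlinarith
    · simp only [g, mul_sub, Finset.sum_sub_distrib, ← Finset.sum_mul, hq.2]
      simp
  have hw : ∀ z : Fin n → Z, 0 ≤ ∏ j, q (z j) := fun z => Finset.prod_nonneg fun j _ => hq.1 _
  calc _ ≤ ∑ z : Fin n → Z, (∏ j, q (z j)) * ∑ z₀, (∑ i, g z₀ (z i)) ^ 2 / (n * δ) ^ 2 :=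
        Finset.sum_le_sum fun z _ => mul_le_mul_of_nonneg_left (hpt z) (hw z)
    _ = ∑ z₀, (∑ z : Fin n → Z, (∏ j, q (z j)) * (∑ i, g z₀ (z i)) ^ 2) / (n * δ) ^ 2 := by
        simp only [Finset.mul_sum, Finset.sum_div]
        rw [Finset.sum_comm]
        simp only [mul_div_assoc]
    _ ≤ ∑ _z₀ : Z, (n : ℝ) / (n * δ) ^ 2 := Finset.sum_le_sum fun z₀ _ => by
        gcongr
        exact hvar z₀
    _ = _ := by
        simp only [Finset.sum_const, Finset.card_univ, nsmul_eq_mul]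
        field_simp

end Typical

/-! ### The covering lemma -/

/-- One-shot covering: if `Q ≤ K · PU × PV` on `T`, then some codebook of `M` elements of `V`
misses `T` with probability at most `Q(Tᶜ) + exp (-M / K)`. The bound holds on average over
independent codewords with distribution `PV`. -/
lemma exists_codebook {U V : Type*} [Fintype U] [Fintype V] {Q : U × V → ℝ} {PU : U → ℝ}
    {PV : V → ℝ} (hQ : Q ∈ stdSimplex ℝ (U × V)) (hPU : ∀ u, ∑ v, Q (u, v) = PU u)
    (hPV : PV ∈ stdSimplex ℝ V) (T : U → V → Prop) [∀ u v, Decidable (T u v)] {K : ℝ} (hK : 0 < K)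
    (hT : ∀ u v, T u v → Q (u, v) ≤ K * (PU u * PV v)) (M : ℕ) :
    ∃ C : Fin M → V, ∑ u, PU u * (∏ m, if T u (C m) then 0 else 1) ≤
      ∑ z : U × V, Q z * (if T z.1 z.2 then 0 else 1) + Real.exp (-(M / K)) := by
  have hPU0 : ∀ u, 0 ≤ PU u := fun u => by
    rw [← hPU]
    exact Finset.sum_nonneg fun v _ => hQ.1 _
  have hPU1 : ∑ u, PU u = 1 := by simp only [← hPU, ← Fintype.sum_prod_type, hQ.2]
  have hV : Nonempty V := by
    by_contra h
    rw [not_nonempty_iff] at h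
    simpa using hPV.2
  let f : (Fin M → V) → ℝ := fun C => ∑ u, PU u * (∏ m, if T u (C m) then 0 else 1)
  let W : (Fin M → V) → ℝ := fun C => ∏ m, PV (C m)
  have hW0 : ∀ C, 0 ≤ W C := fun C => Finset.prod_nonneg fun m _ => hPV.1 _
  have hW1 : ∑ C, W C = 1 := sum_prod_eq_one (r := fun _ => PV) fun _ => hPV.2
  obtain ⟨C, hC⟩ := Finite.exists_min f
  refine ⟨C, ?_⟩
  -- the mass that `Q` gives to `T` above `u`
  let A : U → ℝ := fun u => ∑ v, Q (u, v) * (if T u v then 1 else 0)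
  have hcompl : ∀ u v, (if T u v then (0 : ℝ) else 1) = 1 - if T u v then 1 else 0 := by
    intro u v
    split_ifs <;> norm_num
  have hmean : ∑ C, W C * f C = ∑ u, PU u * (1 - ∑ v, PV v * if T u v then 1 else 0) ^ M := by
    simp only [f, W, Finset.mul_sum]
    rw [Finset.sum_comm]
    refine Finset.sum_congr rfl fun u _ => ?_
    have h1 : ∀ C : Fin M → V, (∏ m, PV (C m)) * (PU u * ∏ m, if T u (C m) then 0 else 1) =
        PU u * ∏ m, (PV (C m) * if T u (C m) then 0 else 1) := by
      intro C
      rw [Finset.prod_mul_distrib]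
      ring
    simp only [h1]
    rw [← Finset.mul_sum, ← Fintype.prod_sum fun (_ : Fin M) v => PV v * if T u v then 0 else 1]
    simp only [hcompl, mul_sub, mul_one, Finset.sum_sub_distrib, hPV.2, Finset.prod_const,
      Finset.card_univ, Fintype.card_fin]
  have hterm : ∀ u, PU u * (1 - ∑ v, PV v * if T u v then 1 else 0) ^ M ≤
      PU u - A u + PU u * Real.exp (-(M / K)) := by
    intro u
    set s := ∑ v, PV v * if T u v then 1 else 0 with hs
    have hA0 : 0 ≤ A u := Finset.sum_nonneg fun v _ =>
      mul_nonneg (hQ.1 _) (by split_ifs <;> norm_num)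
    have hA1 : A u ≤ PU u := by
      rw [← hPU]
      exact Finset.sum_le_sum fun v _ => mul_le_of_le_one_right (hQ.1 _)
        (by split_ifs <;> norm_num)
    have hs1 : s ≤ 1 := by
      rw [← hPV.2]
      exact Finset.sum_le_sum fun v _ => mul_le_of_le_one_right (hPV.1 _)
        (by split_ifs <;> norm_num)
    have hAs : A u ≤ K * PU u * s := by
      rw [hs, Finset.mul_sum]
      refine Finset.sum_le_sum fun v _ => ?_
      split_ifs with h
      · have := hT u v h
        linarith
      · simp
    rcases (hPU0 u).eq_or_lt with h0 | h0
    · rw [← h0] at hA1 ⊢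
      simp only [zero_mul]
      linarith
    · obtain ⟨t, ht⟩ : ∃ t, A u = PU u * t := ⟨A u / PU u, (mul_div_cancel₀ _ h0.ne').symm⟩
      rw [ht] at hA0 hA1 hAs
      have ht0 : 0 ≤ t := nonneg_of_mul_nonneg_right hA0 h0
      have ht1 : t ≤ 1 := le_of_mul_le_mul_left (by linarith) h0
      have hts : t ≤ K * s := le_of_mul_le_mul_left (by linarith) h0
      have hpow : (1 - s) ^ M ≤ 1 - t + Real.exp (-(M / K)) := by
        calc (1 - s) ^ M ≤ Real.exp (-s) ^ M := by
              gcongr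
              exact Real.one_sub_le_exp_neg s
          _ = Real.exp (-(M * s)) := by rw [← Real.exp_nat_mul, mul_neg]
          _ ≤ Real.exp (t * -(M / K) + (1 - t) * 0) := by
              refine Real.exp_le_exp.2 ?_
              have : t / K ≤ s := (div_le_iff₀' hK).2 hts
              have := mul_le_mul_of_nonneg_left this (Nat.cast_nonneg (α := ℝ) M)
              calc _ ≤ -(M * (t / K)) := by linarith
                _ = _ := by ring
          _ ≤ t * Real.exp (-(M / K)) + (1 - t) * Real.exp 0 :=
              convexOn_exp.2 (Set.mem_univ _) (Set.mem_univ _) ht0 (by linarith) (by ring)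
          _ ≤ 1 - t + Real.exp (-(M / K)) := by
              rw [Real.exp_zero]
              nlinarith [Real.exp_pos (-(M / K))]
      rw [ht]
      calc _ ≤ PU u * (1 - t + Real.exp (-(M / K))) := by gcongr
        _ = _ := by ring
  have hAsum : ∑ u, (PU u - A u) = ∑ z : U × V, Q z * (if T z.1 z.2 then 0 else 1) := by
    rw [Fintype.sum_prod_type]
    simp only [hcompl, mul_sub, mul_one, Finset.sum_sub_distrib, hPU, A]
  calc f C = ∑ C', W C' * f C := by rw [← Finset.sum_mul, hW1, one_mul]
    _ ≤ ∑ C', W C' * f C' := Finset.sum_le_sum fun C' _ =>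
        mul_le_mul_of_nonneg_left (hC C') (hW0 C')
    _ ≤ ∑ u, (PU u - A u + PU u * Real.exp (-(M / K))) := by
        rw [hmean]
        exact Finset.sum_le_sum fun u _ => hterm u
    _ = _ := by rw [Finset.sum_add_distrib, hAsum, ← Finset.sum_mul, hPU1, one_mul]

section Covering

variable {X Y : Type*} [Fintype X] [DecidableEq X] [Fintype Y] [DecidableEq Y] {n : ℕ}

/-- The information density `log (q(x,y) / (q(x) q(y)))`, in bits. -/
def infoDensity (q : X × Y → ℝ) (z : X × Y) : ℝ :=
  Real.logb 2 (q z / ((∑ y, q (z.1, y)) * ∑ x, q (x, z.2)))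

lemma prod_le_of_isTypical {q : X × Y → ℝ} (hq : ∀ z, 0 ≤ q z) {δ : ℝ} {z : Fin n → X × Y}
    (hz : IsTypical q δ z) (hn : 0 < n) :
    ∏ i, q (z i) ≤ (2 : ℝ) ^ (n * (shannonMutualInfo q + δ * ∑ z, |infoDensity q z|)) *
      ((∏ i, ∑ y, q ((z i).1, y)) * ∏ i, ∑ x, q (x, (z i).2)) := by
  have hn' : (0 : ℝ) < n := by exact_mod_cast hn
  have hx0 : ∀ x, 0 ≤ ∑ y, q (x, y) := fun x => Finset.sum_nonneg fun _ _ => hq _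
  have hy0 : ∀ y, 0 ≤ ∑ x, q (x, y) := fun x => Finset.sum_nonneg fun _ _ => hq _
  have hprod0 : 0 ≤ (∏ i, ∑ y, q ((z i).1, y)) * ∏ i, ∑ x, q (x, (z i).2) :=
    mul_nonneg (Finset.prod_nonneg fun _ _ => hx0 _) (Finset.prod_nonneg fun _ _ => hy0 _)
  by_cases h0 : ∃ i, q (z i) = 0
  · obtain ⟨i, hi⟩ := h0
    rw [Finset.prod_eq_zero (Finset.mem_univ i) hi]
    positivity
  · push Not at h0
    have hpos : ∀ i, 0 < q (z i) := fun i => (hq _).lt_of_ne' (h0 i)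
    have hfac : ∀ i, q (z i) = (2 : ℝ) ^ infoDensity q (z i) *
        ((∑ y, q ((z i).1, y)) * ∑ x, q (x, (z i).2)) := by
      intro i
      have hx : 0 < ∑ y, q ((z i).1, y) := (hpos i).trans_le
        (Finset.single_le_sum (f := fun y => q ((z i).1, y)) (fun _ _ => hq _)
          (Finset.mem_univ (z i).2))
      have hy : 0 < ∑ x, q (x, (z i).2) := (hpos i).trans_le
        (Finset.single_le_sum (f := fun x => q (x, (z i).2)) (fun _ _ => hq _)
          (Finset.mem_univ (z i).1))
      rw [infoDensity, Real.rpow_logb two_pos (by norm_num)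
        (div_pos (hpos i) (mul_pos hx hy))]
      field_simp
    calc ∏ i, q (z i) = ∏ i, (2 : ℝ) ^ infoDensity q (z i) *
          ((∑ y, q ((z i).1, y)) * ∑ x, q (x, (z i).2)) :=
          Finset.prod_congr rfl fun i _ => hfac i
      _ = (2 : ℝ) ^ (∑ i, infoDensity q (z i)) *
          ((∏ i, ∑ y, q ((z i).1, y)) * ∏ i, ∑ x, q (x, (z i).2)) := by
          rw [Finset.prod_mul_distrib, Finset.prod_mul_distrib,
            Real.rpow_sum_of_pos two_pos]
      _ ≤ _ := by
          gcongr
          · exact one_le_two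
          · have h1 : ∑ i, infoDensity q (z i) =
                n * ∑ z₀, empirical z z₀ * infoDensity q z₀ := by
              rw [sum_empirical_mul]
              field_simp
            rw [h1, shannonMutualInfo_eq_sum hq, Finset.mul_sum _ _ δ,
              ← Finset.sum_add_distrib]
            gcongr with z₀
            have h2 := (le_abs_self _).trans (abs_mul (empirical z z₀ - q z₀) (infoDensity q z₀)).le
            have h3 := mul_le_mul_of_nonneg_right (hz z₀) (abs_nonneg (infoDensity q z₀))
            simp only [infoDensity] at h2 h3 ⊢
            linarith

open Classical in
/-- A codebook of `M ≥ 2^{n(I(X;Y)+δ')}` sequences contains, for most source sequences, a jointly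
typical codeword. -/
lemma exists_typical_codebook {q : X × Y → ℝ} (hq : q ∈ stdSimplex ℝ (X × Y)) {δ : ℝ}
    (hδ : 0 < δ) (hn : 0 < n) (M : ℕ) :
    ∃ C : Fin M → Fin n → Y,
      ∑ x : Fin n → X, (∏ i, ∑ y, q (x i, y)) *
          (if ∃ m, IsTypical q δ (fun i => (x i, C m i)) then 0 else 1) ≤
        Fintype.card (X × Y) / (n * δ ^ 2) +
          Real.exp (-(M / (2 : ℝ) ^ (n * (shannonMutualInfo q + δ * ∑ z, |infoDensity q z|)))) := by
  let e := Equiv.arrowProdEquivProdArrow (Fin n) (fun _ => X) (fun _ => Y)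
  let Q : (Fin n → X) × (Fin n → Y) → ℝ := fun u => ∏ i, q (u.1 i, u.2 i)
  have hQ : Q ∈ stdSimplex ℝ ((Fin n → X) × (Fin n → Y)) := by
    refine ⟨fun u => Finset.prod_nonneg fun i _ => hq.1 _, ?_⟩
    rw [← e.sum_comp]
    exact sum_prod_eq_one (r := fun _ => q) fun _ => hq.2
  have hPV : (fun v : Fin n → Y => ∏ i, ∑ x, q (x, v i)) ∈ stdSimplex ℝ (Fin n → Y) := by
    refine ⟨fun v => Finset.prod_nonneg fun i _ => Finset.sum_nonneg fun _ _ => hq.1 _, ?_⟩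
    refine sum_prod_eq_one (r := fun _ y => ∑ x, q (x, y)) fun _ => ?_
    rw [← Fintype.sum_prod_type_right, hq.2]
  obtain ⟨C, hC⟩ := exists_codebook (PU := fun x : Fin n → X => ∏ i, ∑ y, q (x i, y)) hQ
    (fun x => (Fintype.prod_sum fun i y => q (x i, y)).symm) hPV
    (fun x y => IsTypical q δ fun i => (x i, y i))
    (K := (2 : ℝ) ^ (n * (shannonMutualInfo q + δ * ∑ z, |infoDensity q z|))) (by positivity)
    (fun x y h => prod_le_of_isTypical hq.1 h hn) M
  refine ⟨C, ?_⟩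
  have hmiss : ∀ x : Fin n → X,
      (∏ m, if IsTypical q δ (fun i => (x i, C m i)) then (0 : ℝ) else 1) =
        if ∃ m, IsTypical q δ (fun i => (x i, C m i)) then 0 else 1 := by
    intro x
    split_ifs with h
    · obtain ⟨m, hm⟩ := h
      exact Finset.prod_eq_zero (Finset.mem_univ m) (if_pos hm)
    · exact Finset.prod_eq_one fun m _ => if_neg fun hm => h ⟨m, hm⟩
  simp only [hmiss] at hC
  refine hC.trans (add_le_add_left ?_ _)
  rw [← e.sum_comp]
  exact sum_not_isTypical_le hq hδ hn

end Covering

/-! ### Achievability -/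

section Achievability

variable {X Y a b : Type*} [Fintype X] [DecidableEq X] [Fintype Y] [DecidableEq Y]
  [Fintype a] [DecidableEq a] [Fintype b] [DecidableEq b]

omit [DecidableEq Y] in
lemma exists_traceNorm_ensembleState_sub_le (q : X × Y → ℝ) (σA : X → Matrix a a ℂ)
    (σB : Y → Matrix b b ℂ) :
    ∃ B : ℝ, 0 < B ∧ ∀ (q' : X × Y → ℝ) (η : ℝ), 0 ≤ η → (∀ z, |q' z - q z| ≤ η) →
      traceNorm (ensembleState q' σA σB - ensembleState q σA σB) ≤ B * η := by
  let S : ℝ := ∑ s : X × (a × b), ∑ t : X × (a × b), ∑ x, ∑ y,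
    ‖(basisProj x ⊗ₖ (σA x ⊗ₖ σB y)) t s‖
  have hS : 0 ≤ S := by positivity
  refine ⟨Fintype.card (X × (a × b)) * S + 1, by positivity, fun q' η hη h => ?_⟩
  have hentry : ∀ s t, ‖(ensembleState q' σA σB - ensembleState q σA σB) t s‖ ≤
      η * ∑ x, ∑ y, ‖(basisProj x ⊗ₖ (σA x ⊗ₖ σB y)) t s‖ := by
    intro s t
    simp only [ensembleState, ← Finset.sum_sub_distrib, ← sub_smul, Matrix.sum_apply,
      Finset.mul_sum]
    refine (norm_sum_le _ _).trans (Finset.sum_le_sum fun x _ => ?_)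
    refine (norm_sum_le _ _).trans (Finset.sum_le_sum fun y _ => ?_)
    rw [Matrix.smul_apply, norm_smul, ← Complex.ofReal_sub, Complex.norm_real, Real.norm_eq_abs]
    exact mul_le_mul_of_nonneg_right (h _) (norm_nonneg _)
  calc _ ≤ Fintype.card (X × (a × b)) *
        ∑ s, ∑ t, ‖(ensembleState q' σA σB - ensembleState q σA σB) t s‖ := traceNorm_le _
    _ ≤ Fintype.card (X × (a × b)) * (η * S) := by
        gcongr
        simp only [S]
        rw [Finset.mul_sum]
        refine Finset.sum_le_sum fun s _ => ?_
        rw [Finset.mul_sum]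
        exact Finset.sum_le_sum fun t _ => hentry s t
    _ ≤ _ := by nlinarith

omit [Fintype Y] [DecidableEq a] [DecidableEq b] in
lemma labelDist_deterministic {n M : ℕ} (p : X → ℝ) (c : Code X a b n M)
    (f : (Fin n → X) → Fin M) (hf : ∀ x m, c.enc x m = if m = f x then 1 else 0)
    (C : Fin M → Fin n → Y) (z : X × Y) :
    c.labelDist p (fun i m => C m i) z =
      ∑ x : Fin n → X, (∏ j, p (x j)) * empirical (fun i => (x i, C (f x) i)) z := by
  simp only [Code.labelDist, empirical, hf, Finset.mul_sum]
  rw [Finset.sum_comm]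
  refine Finset.sum_congr rfl fun x _ => Finset.sum_congr rfl fun i _ => ?_
  rw [Finset.sum_eq_single (f x)]
  · rw [if_pos (rfl : f x = f x)]
    split_ifs <;> simp [mul_comm]
  · intro m _ hm
    simp [hm]
  · simp

open Classical in
/-- Codewords `yⁿ(m)` give deterministic codes in which Bob prepares `⨂ᵢ σ_B^{yᵢ(m)}`. -/
lemma exists_code_labelDist {n M : ℕ} {p : X → ℝ} {q : X × Y → ℝ}
    (hp : ∀ x, ∑ y, q (x, y) = p x) (hq : q ∈ stdSimplex ℝ (X × Y)) {σA : X → Matrix a a ℂ}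
    {σB : Y → Matrix b b ℂ}
    (hA : ∀ x, IsDensity (σA x)) (hB : ∀ y, IsDensity (σB y)) (hM : 0 < M)
    (C : Fin M → Fin n → Y) {δ : ℝ} (hδ : 0 ≤ δ) :
    ∃ (c : Code X a b n M) (q' : X × Y → ℝ),
      c.averageState p = ensembleState q' σA σB ∧
      ∀ z, |q' z - q z| ≤ δ + ∑ x : Fin n → X, (∏ i, p (x i)) *
        (if ∃ m, IsTypical q δ (fun i => (x i, C m i)) then 0 else 1) := by
  let f : (Fin n → X) → Fin M := fun x =>
    if h : ∃ m, IsTypical q δ (fun i => (x i, C m i)) then h.choose else ⟨0, hM⟩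
  let c : Code X a b n M :=
    { enc := fun x m => if m = f x then 1 else 0
      enc_mem := fun x => ⟨fun m => by dsimp only; split_ifs <;> norm_num, by simp⟩
      alice := σA
      alice_density := hA
      bob := fun m => tensorPi fun i => σB (C m i)
      bob_density := fun m => isDensity_tensorPi fun i => hB _ }
  have hp0 : ∀ x : Fin n → X, 0 ≤ ∏ i, p (x i) := fun x => Finset.prod_nonneg fun i _ => by
    rw [← hp]
    exact Finset.sum_nonneg fun y _ => hq.1 _
  have hp1 : ∑ x : Fin n → X, ∏ i, p (x i) = 1 :=
    sum_prod_eq_one (r := fun _ => p) fun _ => by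
      simp only [← hp, ← Fintype.sum_prod_type, hq.2]
  refine ⟨c, c.labelDist p fun i m => C m i, c.averageState_eq_ensembleState p _ fun i m =>
    marginal_tensorPi (fun j => (hB _).2) i, fun z => ?_⟩
  rw [labelDist_deterministic p c f (fun x m => by simp [c]) C z]
  have hdev : ∀ x : Fin n → X, |empirical (fun i => (x i, C (f x) i)) z - q z| ≤
      δ + if ∃ m, IsTypical q δ (fun i => (x i, C m i)) then 0 else 1 := by
    intro x
    split_ifs with h
    · have hfx : f x = h.choose := dif_pos h
      rw [hfx, add_zero]
      exact h.choose_spec z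
    · have hq1 : q z ≤ 1 := (Finset.single_le_sum (fun z _ => hq.1 z) (Finset.mem_univ z)).trans
        hq.2.le
      have h1 := empirical_nonneg (fun i => (x i, C (f x) i)) z
      have h2 := empirical_le_one (fun i => (x i, C (f x) i)) z
      have h3 := hq.1 z
      rw [abs_le]
      constructor <;> linarith
  calc |∑ x : Fin n → X, (∏ j, p (x j)) * empirical (fun i => (x i, C (f x) i)) z - q z|
      = |∑ x : Fin n → X, (∏ j, p (x j)) * (empirical (fun i => (x i, C (f x) i)) z - q z)| := by
        simp only [mul_sub, Finset.sum_sub_distrib, ← Finset.sum_mul, hp1, one_mul]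
    _ ≤ ∑ x : Fin n → X, |(∏ j, p (x j)) * (empirical (fun i => (x i, C (f x) i)) z - q z)| :=
        Finset.abs_sum_le_sum_abs _ _
    _ ≤ ∑ x : Fin n → X, (∏ j, p (x j)) *
          (δ + if ∃ m, IsTypical q δ (fun i => (x i, C m i)) then 0 else 1) := by
        refine Finset.sum_le_sum fun x _ => ?_
        rw [abs_mul, abs_of_nonneg (hp0 x)]
        exact mul_le_mul_of_nonneg_left (hdev x) (hp0 x)
    _ = _ := by simp only [mul_add, Finset.sum_add_distrib, ← Finset.sum_mul, hp1, one_mul]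

open Filter Topology in
/-- The probability of a missing codeword tends to zero. -/
lemma eventually_error_le (K : ℝ) {δ α η : ℝ} (hδ : 0 < δ) (hα : 0 < α) (hη : 0 < η) :
    ∀ᶠ n : ℕ in atTop, K / (n * δ ^ 2) + Real.exp (1 - (2 : ℝ) ^ ((n : ℝ) * α)) ≤ η := by
  have h1 : Tendsto (fun n : ℕ => K / (n * δ ^ 2)) atTop (𝓝 0) :=
    tendsto_const_nhds.div_atTop
      (tendsto_natCast_atTop_atTop.atTop_mul_const (by positivity))
  have h2 : Tendsto (fun n : ℕ => (2 : ℝ) ^ ((n : ℝ) * α)) atTop atTop :=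
    (tendsto_rpow_atTop_of_base_gt_one 2 one_lt_two).comp
      (tendsto_natCast_atTop_atTop.atTop_mul_const hα)
  have h3 : Tendsto (fun n : ℕ => Real.exp (1 - (2 : ℝ) ^ ((n : ℝ) * α))) atTop (𝓝 0) :=
    Real.tendsto_exp_atBot.comp (tendsto_atBot_add_const_left _ 1
      (tendsto_neg_atTop_atBot.comp h2))
  have h := h1.add h3
  rw [add_zero] at h
  exact (h.eventually (gt_mem_nhds hη)).mono fun n hn => le_of_lt hn

/-- Direct part of the coding theorem: random codebooks achieve the mutual information of every
ensemble that realizes the target state. -/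
theorem achievable_shannonMutualInfo {p : X → ℝ} {ω : X → Matrix (a × b) (a × b) ℂ}
    (hω : ∀ x, IsDensity (ω x)) {q : X × Y → ℝ} (hq : q ∈ stdSimplex ℝ (X × Y))
    {σA : X → Matrix a a ℂ} {σB : Y → Matrix b b ℂ} (hA : ∀ x, IsDensity (σA x))
    (hB : ∀ y, IsDensity (σB y)) (h : ensembleState q σA σB = cqState p ω) :
    Achievable p ω (shannonMutualInfo q) := by
  classical
  have hp := sum_eq_of_ensembleState_eq hA hB hω h
  have hI := shannonMutualInfo_nonneg hq
  refine ⟨hI, fun ε hε α hα => ?_⟩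
  obtain ⟨B, hB0, hBnorm⟩ := exists_traceNorm_ensembleState_sub_le q σA σB
  let L := ∑ z, |infoDensity q z|
  have hL : 0 ≤ L := Finset.sum_nonneg fun _ _ => abs_nonneg _
  let η := ε / B
  have hη : 0 < η := div_pos hε hB0
  -- `δ` leaves room `α / 2` in the exponent of the number of messages
  let δ := min (η / 2) (α / 2 / (L + 1))
  have hδ : 0 < δ := lt_min (by positivity) (by positivity)
  have hδL : δ * L ≤ α / 2 := by
    have h1 : δ * (L + 1) ≤ α / 2 := (le_div_iff₀ (by positivity)).1 (min_le_right _ _)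
    nlinarith
  obtain ⟨N, hN⟩ := Filter.eventually_atTop.1
    (eventually_error_le (Fintype.card (X × Y) : ℝ) hδ (half_pos hα) (half_pos hη))
  refine ⟨max N 1, fun n hn => ?_⟩
  have hn0 : 0 < n := (le_max_right N 1).trans hn
  have herr := hN n ((le_max_left N 1).trans hn)
  have hn' : (0 : ℝ) < n := by exact_mod_cast hn0
  have h1M : 1 ≤ (2 : ℝ) ^ ((n : ℝ) * (shannonMutualInfo q + α)) :=
    Real.one_le_rpow one_le_two (mul_nonneg hn'.le (by linarith))
  have hM : 0 < ⌊(2 : ℝ) ^ ((n : ℝ) * (shannonMutualInfo q + α))⌋₊ := Nat.floor_pos.2 h1M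
  have hMlt := Nat.lt_floor_add_one ((2 : ℝ) ^ ((n : ℝ) * (shannonMutualInfo q + α)))
  generalize ⌊(2 : ℝ) ^ ((n : ℝ) * (shannonMutualInfo q + α))⌋₊ = M at hM hMlt
  obtain ⟨C, hC⟩ := exists_typical_codebook hq hδ hn0 M
  obtain ⟨c, q', hcq, hq'⟩ := exists_code_labelDist hp hq hA hB hM C hδ.le
  refine ⟨c, ?_⟩
  simp only [hp] at hC
  have hratio : (2 : ℝ) ^ ((n : ℝ) * (α / 2)) - 1 ≤
      M / (2 : ℝ) ^ (n * (shannonMutualInfo q + δ * L)) := by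
    rw [le_div_iff₀ (by positivity)]
    have h1 : (1 : ℝ) ≤ (2 : ℝ) ^ (n * (shannonMutualInfo q + δ * L)) :=
      Real.one_le_rpow one_le_two (by positivity)
    have h2 : (2 : ℝ) ^ ((n : ℝ) * (α / 2)) * (2 : ℝ) ^ (n * (shannonMutualInfo q + δ * L)) ≤
        (2 : ℝ) ^ ((n : ℝ) * (shannonMutualInfo q + α)) := by
      rw [← Real.rpow_add two_pos]
      refine Real.rpow_le_rpow_of_exponent_le one_le_two ?_
      rw [← mul_add]
      exact mul_le_mul_of_nonneg_left (by linarith) hn'.le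
    nlinarith
  have hexp : Real.exp (-(M / (2 : ℝ) ^ (n * (shannonMutualInfo q + δ * L)))) ≤
      Real.exp (1 - (2 : ℝ) ^ ((n : ℝ) * (α / 2))) := Real.exp_le_exp.2 (by linarith)
  rw [hcq, ← h]
  calc traceNorm (ensembleState q' σA σB - ensembleState q σA σB) ≤ B * η := by
        refine hBnorm q' η hη.le fun z => (hq' z).trans ?_
        have h1 : δ ≤ η / 2 := min_le_left _ _
        linarith
    _ = ε := mul_div_cancel₀ _ hB0.ne'

end Achievability

end EmpiricalCoordination

end

theorem mainTheorem1 {X a b : Type*} [Fintype X] [DecidableEq X] [Fintype a] [DecidableEq a]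
    [Fintype b] [DecidableEq b] (p : X → ℝ) (hp : p ∈ stdSimplex ℝ X)
    (ω : X → Matrix (a × b) (a × b) ℂ) (hω : ∀ x, EmpiricalCoordination.IsDensity (ω x)) :
    ((EmpiricalCoordination.extensions p ω).Nonempty →
      (∃ R, EmpiricalCoordination.Achievable p ω R) ∧
      EmpiricalCoordination.capacity p ω =
        sInf ((fun σ => EmpiricalCoordination.mutualInfo
          (EmpiricalCoordination.reduceXY σ.2)) '' EmpiricalCoordination.extensions p ω)) ∧
    (EmpiricalCoordination.extensions p ω = ∅ →
      ¬ ∃ R, EmpiricalCoordination.Achievable p ω R) ∧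
    (¬ EmpiricalCoordination.IsSeparable (EmpiricalCoordination.averageAB p ω) →
      EmpiricalCoordination.extensions p ω = ∅) := by
  open EmpiricalCoordination in
  have hdirect : ∀ σ ∈ extensions p ω, Achievable p ω (mutualInfo (reduceXY σ.2)) := by
    intro σ hσ
    obtain ⟨q, σA, σB, hq, hA, hB, hs, hI⟩ := exists_ensemble_of_mem_extensions hσ
    rw [hI]
    exact achievable_shannonMutualInfo hω hq hA hB hs
  refine ⟨fun hne => ?_, fun hempty => ?_, fun hsep => ?_⟩
  · obtain ⟨σ₀, hσ₀⟩ := hne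
    refine ⟨⟨_, hdirect σ₀ hσ₀⟩, le_antisymm ?_ ?_⟩
    · refine le_csInf (Set.Nonempty.image _ ⟨σ₀, hσ₀⟩) ?_
      rintro _ ⟨σ, hσ, rfl⟩
      have hbdd : BddBelow {R | EmpiricalCoordination.Achievable p ω R} := ⟨0, fun R hR => hR.1⟩
      exact csInf_le hbdd (hdirect σ hσ)
    · refine le_csInf ⟨_, hdirect σ₀ hσ₀⟩ fun R hR => ?_
      obtain ⟨σ, hσ, hle⟩ := hR.exists_mutualInfo_le hp hω
      refine le_trans (csInf_le ⟨0, ?_⟩ (Set.mem_image_of_mem _ hσ)) hle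
      rintro _ ⟨σ', hσ', rfl⟩
      exact (hdirect σ' hσ').1
  · rintro ⟨R, hR⟩
    obtain ⟨σ, hσ, -⟩ := hR.exists_mutualInfo_le hp hω
    rw [hempty] at hσ
    exact hσ
  · by_contra hne
    exact hsep (isSeparable_averageAB (Set.nonempty_iff_ne_empty.2 hne))
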